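/- **Conventions.** All groups are discrete. A group has a property *locally* if all its finitely generated subgroups have it; it is *virtually abelian* if it has an abelian subgroup of finite index. Say that a group $G$ has an *LVA-series* if there is a subnormal series $\{1\}=H_0\triangleleft H_1\triangleleft\cdots\triangleleft H_n=G$ in which every factor $H_{i+1}/H_i$ is locally virtually abelian. A *pointed dynamical system* $(G,X,0)$ is a group $G$ acting continuously on a compact metric space $(X,d)$ with a point $0\in X$ fixed by $G$. It is *expansive* if there is $0<\Delta\le 1$ such that $d(g x,g y)\le\Delta$ for all $g\in G$ implies $x=y$. A point $x$ is *homoclinic* if for every $\epsilon>0$ one has $d(gx,0)<\epsilon$ for all but finitely many $g\in G$. For $E\subseteq G$ and $\delta>0$, a *$(\delta,E)$-designation* is a family $(A_i,x_i)_{i\in I}$ such that $(A_i)_{i\in I}$ is a partition of $G$, $x_i\in X$, and $d(gx_i,0)<\delta$ whenever $g\in A_i$ and $Eg\not\subseteq A_i$; an *$\epsilon$-realization* of it is a point $y\in X$ with $d(gy,gx_i)<\epsilon$ for all $i\in I$ and $g\in A_i$. The system is *$0$-gluing* if for every $\epsilon>0$ there are $\delta>0$ and a finite $E\subseteq G$ such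 that every $(\delta,E)$-designation has an $\epsilon$-realization. An *endomorphism* is a continuous $G$-equivariant map $f:X\to X$ with $f(0)=0$. A map $f:X\to X$ is *asymptotically nilpotent* if $f^n(x)\to 0$ for every $x\in X$, and *nilpotent* if $f^n(X)=\{0\}$ for some $n$. A *tiered dynamical system* $\mathcal X$ consists of a compact metric space $X$ with a point $0\in X$, a directed set $\mathcal T$ with least element $t_0$, for each $t\in\mathcal T$ an expansive pointed dynamical system $(G_t,X_t,0)$ with $0\in X_t\subseteq X$, such that $X_t\subseteq X_{t'}$ for $t\le t'$, and finite-to-one surjective homomorphisms $\phi^{t'}_t:G_{t'}\to G_t$ for $t\le t'$ with $\phi^t_t=\mathrm{id}$, $\phi^{t'}_t\circ\phi^{t''}_{t'}=\phi^{t''}_t$ for $t\le t'\le t''$, and $\phi^{t'}_t(g)\cdot x=g\cdot x$ for $t\le t'$, $x\in X_t$, $g\in G_{t'}$. Its *base group* is $G_{t_0}$. An *evolution* of $\mathcal X$ is a continuous map $f:X\to X$ such that, for $t\le t'$ and $x\in X_t$ with $f(x)\in X_{t'}$, one has $f(\phi^{t'}_t(g)\cdot x)=g\cdot f(x)$ for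 all $g\in G_{t'}$. The pair $(\mathcal X,f)$ belongs to $\mathfrak C_2$ if for every $t\in\mathcal T$: - there is $s\ge t$ with $f^k(X_t)\subseteq X_s$ for all $k\ge0$; - there is $w\ge t$ such that for every $\epsilon>0$ there are $\delta>0$ and a finite $E\subseteq G_w$ such that every $(\delta,E)$-designation $(A_i,x_i)_{i\in I}$ in $(G_w,X_w,0)$ with all $x_i\in X_t$ has an $\epsilon$-realization in $X_w$; - for every $x\in X_t$ and $\epsilon>0$ there are $t'\ge t$ and a homoclinic point $y$ of $(G_{t'},X_{t'},0)$ with $d(x,y)<\epsilon$. It belongs to $\mathfrak C_3$ if moreover all the groups $G_t$ are residually finite, and to $\mathfrak C_4$ if it belongs to $\mathfrak C_2$ and $\mathcal T$ has a single element. A group $G$ is *nil-rigid on* $\mathfrak C$ if for every tiered system $\mathcal X$ with base group $G$ and every asymptotically nilpotent evolution $f:X\to X$ with $(\mathcal X,f)\in\mathfrak C$, for each $t\in\mathcal T$ there is $n$ with $f^n(x)=0$ for all $x\in X_t$. **Theorem.** 1. Let $G$ be a group such that every finitely generated subgroup of $G$ is residually finite and has an LVA-series. Let $(G,X,0)$ be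 an expansive $0$-gluing pointed dynamical system whose homoclinic points are dense in $X$. Then every asymptotically nilpotent endomorphism $f:X\to X$ is nilpotent. 2. Every residually finite group with an LVA-series is nil-rigid on $\mathfrak C_3$. 3. If a group $G$ is locally nil-rigid on $\mathfrak C_2$, or locally nil-rigid on $\mathfrak C_4$, or both locally nil-rigid on $\mathfrak C_3$ and locally residually finite, then $G$ is nil-rigid on $\mathfrak C_4$. -/

import Mathlib

open Filter Topology

universe u v

/-! ### Classes of groups -/

/-- `G` has an abelian subgroup of finite index. -/
def IsVirtuallyAbelian (G : Type u) [Group G] : Prop :=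
  ∃ A : Subgroup G, A.FiniteIndex ∧ IsMulCommutative A

/-- Every finitely generated subgroup of `G` is virtually abelian. -/
def IsLocallyVirtuallyAbelian (G : Type u) [Group G] : Prop :=
  ∀ H : Subgroup G, H.FG → IsVirtuallyAbelian H

/-- `G` has a subnormal series `1 = S 0 ◁ S 1 ◁ ⋯ ◁ S n = G` (of some length `n ≥ 0`) in which every
factor `S (i + 1) / S i` is locally virtually abelian. -/
def HasLocallyVirtuallyAbelianSeries (G : Type u) [Group G] : Prop :=
  ∃ (n : ℕ) (S : ℕ → Subgroup G), S 0 = ⊥ ∧ S n = ⊤ ∧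
    ∀ i < n, S i ≤ S (i + 1) ∧
      ∃ _ : ((S i).subgroupOf (S (i + 1))).Normal,
        IsLocallyVirtuallyAbelian (S (i + 1) ⧸ (S i).subgroupOf (S (i + 1)))

/-! ### Pointed dynamical systems

A pointed dynamical system is a group `G` acting by homeomorphisms on a compact metric space `X`,
with a point `o : X` fixed by `G`. -/

section Systems

variable (G : Type u) {X : Type v} [Group G] [MetricSpace X] [MulAction G X]

/-- `Δ` is an expansivity constant of the system. -/
def IsExpansivityConstant (X : Type v) [MetricSpace X] [MulAction G X] (Δ : ℝ) : Prop :=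
  0 < Δ ∧ Δ ≤ 1 ∧ ∀ x y : X, (∀ g : G, dist (g • x) (g • y) ≤ Δ) → x = y

/-- The action of `G` on `X` is expansive. -/
def IsExpansive (X : Type v) [MetricSpace X] [MulAction G X] : Prop :=
  ∃ Δ : ℝ, IsExpansivityConstant G X Δ

/-- `x` is homoclinic (to `o`). -/
def IsHomoclinic (o x : X) : Prop :=
  ∀ ε > (0 : ℝ), ∃ E : Set G, E.Finite ∧ ∀ g ∉ E, dist (g • x) o < ε

variable {G}

/-- The `E`-border of `A`. -/
def border (E A : Set G) : Set G :=
  {g | g ∈ A ∧ ∃ e ∈ E, e * g ∉ A}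

/-- The family `(A i, x i)` is a designation: the sets `A i` are disjoint and cover `G`. (Empty parts
are allowed; they put no condition on anything.) It is moreover a `(δ, E)`-designation: the orbit of
`x i` is `δ`-close to `o` on the `E`-border of `A i`. -/
def IsDesignation (o : X) (δ : ℝ) (E : Set G) {I : Type u} (A : I → Set G) (x : I → X) : Prop :=
  Pairwise (fun i j => Disjoint (A i) (A j)) ∧ (⋃ i, A i) = Set.univ ∧
    ∀ i, ∀ g ∈ border E (A i), dist (g • x i) o < δ

/-- `y` is an `ε`-realization of the designation `(A i, x i)`. -/
def IsRealization (ε : ℝ) {I : Type u} (A : I → Set G) (x : I → X) (y : X) : Prop :=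
  ∀ i, ∀ g ∈ A i, dist (g • y) (g • x i) < ε

variable (G)

/-- The pointed system `(G, X, o)` is `0`-gluing. -/
def IsZeroGluing (o : X) : Prop :=
  ∀ ε > (0 : ℝ), ∃ δ > (0 : ℝ), ∃ E : Set G, E.Finite ∧
    ∀ (I : Type u) (A : I → Set G) (x : I → X), IsDesignation o δ E A x →
      ∃ y : X, IsRealization ε A x y

/-- `f` is an endomorphism of the pointed system `(G, X, o)`. -/
def IsEndomorphism (o : X) (f : X → X) : Prop :=
  Continuous f ∧ f o = o ∧ ∀ (g : G) (x : X), f (g • x) = g • f x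

end Systems

/-- `f ^ n (x) → o` for every `x`. -/
def IsAsymptoticallyNilpotent {X : Type v} [MetricSpace X] (o : X) (f : X → X) : Prop :=
  ∀ x, Tendsto (fun n => f^[n] x) atTop (𝓝 o)

/-- `f ^ n (X) = {o}` for some `n`. -/
def IsNilpotentMap {X : Type v} (o : X) (f : X → X) : Prop :=
  ∃ n : ℕ, Set.range f^[n] = {o}

/-- There is an `n` with `f ^ n (x) = o` for all `x ∈ Y`. -/
def IsNilpotentMapOn {X : Type v} (o : X) (f : X → X) (Y : Set X) : Prop :=
  ∃ n : ℕ, ∀ x ∈ Y, f^[n] x = o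

/-! ### Tiered dynamical systems -/

/-- A tiered dynamical system: a compact metric ambient space with a special point, a directed set of
tiers with a least element, and on each tier (a closed subset containing the special point) an
expansive pointed action of a group of its own; the tiers increase, and the group of a higher tier
maps onto that of a lower tier, with finite fibres and compatibly with the actions. -/
structure TieredSystem where
  /-- the ambient space -/
  Space : Type v
  [metricSpace : MetricSpace Space]
  [compactSpace : CompactSpace Space]
  /-- the special point -/
  zero : Space
  /-- the directed set of tiers -/
  Tier : Type u
  [preorder : Preorder Tier]
  [orderBot : OrderBot Tier]
  [directed : IsDirectedOrder Tier]
  /-- the acting groups -/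
  Grp : Tier → Type u
  [group : ∀ t, Group (Grp t)]
  /-- the subset of the ambient space belonging to a tier -/
  set : Tier → Set Space
  isCompact_set : ∀ t, IsCompact (set t)
  [mulAction : ∀ t, MulAction (Grp t) (set t)]
  [continuousConstSMul : ∀ t, ContinuousConstSMul (Grp t) (set t)]
  zero_mem : ∀ t, zero ∈ set t
  smul_zero : ∀ t (g : Grp t), g • (⟨zero, zero_mem t⟩ : set t) = ⟨zero, zero_mem t⟩
  expansive : ∀ t, IsExpansive (Grp t) (set t)
  set_mono : ∀ {t t' : Tier}, t ≤ t' → set t ⊆ set t'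
  /-- the homomorphism from the group of a higher tier to the group of a lower tier -/
  hom : ∀ {t t' : Tier}, t ≤ t' → Grp t' →* Grp t
  hom_surjective : ∀ {t t' : Tier} (h : t ≤ t'), Function.Surjective (hom h)
  hom_finite_fibre : ∀ {t t' : Tier} (h : t ≤ t') (g : Grp t), (hom h ⁻¹' {g}).Finite
  hom_refl : ∀ t, hom (le_refl t) = MonoidHom.id (Grp t)
  hom_comp : ∀ {t t' t'' : Tier} (h : t ≤ t') (h' : t' ≤ t''),
    (hom h).comp (hom h') = hom (h.trans h')
  hom_smul : ∀ {t t' : Tier} (h : t ≤ t') (g : Grp t') (x : set t),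
    ((hom h g • x : set t) : Space) = (g • (⟨x, set_mono h x.2⟩ : set t') : set t')

namespace TieredSystem

attribute [instance] TieredSystem.metricSpace TieredSystem.compactSpace TieredSystem.preorder
  TieredSystem.orderBot TieredSystem.directed TieredSystem.group TieredSystem.mulAction
  TieredSystem.continuousConstSMul

variable (𝒳 : TieredSystem.{u, v})

/-- The special point, as a point of the tier `t`. -/
def zeroAt (t : 𝒳.Tier) : 𝒳.set t := ⟨𝒳.zero, 𝒳.zero_mem t⟩

/-- `f` is an evolution map: it is continuous, and if `t ≤ t'`, `x ∈ X_t` and `f x ∈ X_{t'}`, then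
`f (φ(g) • x) = g • f x` for every `g ∈ G_{t'}`, where `φ : G_{t'} → G_t`. -/
def IsEvolution (f : 𝒳.Space → 𝒳.Space) : Prop :=
  Continuous f ∧
    ∀ (t t' : 𝒳.Tier) (h : t ≤ t') (x : 𝒳.set t) (hx : f x ∈ 𝒳.set t') (g : 𝒳.Grp t'),
      f (𝒳.hom h g • x : 𝒳.set t) = (g • (⟨f x, hx⟩ : 𝒳.set t') : 𝒳.set t')

/-- Every tier is `f`-stabilizing. -/
def IsStabilizing (f : 𝒳.Space → 𝒳.Space) : Prop :=
  ∀ t : 𝒳.Tier, ∃ s ≥ t, ∀ k : ℕ, f^[k] '' 𝒳.set t ⊆ 𝒳.set s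

/-- Every tier is weakly `0`-gluing. -/
def IsWeaklyZeroGluing : Prop :=
  ∀ t : 𝒳.Tier, ∃ w ≥ t, ∀ ε > (0 : ℝ), ∃ δ > (0 : ℝ), ∃ E : Set (𝒳.Grp w), E.Finite ∧
    ∀ (I : Type u) (A : I → Set (𝒳.Grp w)) (x : I → 𝒳.set w),
      (∀ i, (x i : 𝒳.Space) ∈ 𝒳.set t) → IsDesignation (𝒳.zeroAt w) δ E A x →
        ∃ y : 𝒳.set w, IsRealization ε A x y

/-- The system has weakly dense homoclinic points. -/
def HasWeaklyDenseHomoclinicPoints : Prop :=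
  ∀ (t : 𝒳.Tier), ∀ x ∈ 𝒳.set t, ∀ ε > (0 : ℝ), ∃ t' ≥ t, ∃ y : 𝒳.set t',
    dist x (y : 𝒳.Space) < ε ∧ IsHomoclinic (𝒳.Grp t') (𝒳.zeroAt t') y

end TieredSystem

/-- A class of evolutions of tiered dynamical systems. -/
abbrev EvolutionClass := (𝒳 : TieredSystem.{u, v}) → (𝒳.Space → 𝒳.Space) → Prop

/-- The class `ℭ₂`. -/
def classTwo : EvolutionClass.{u, v} := fun 𝒳 f =>
  𝒳.IsEvolution f ∧ 𝒳.IsStabilizing f ∧ 𝒳.IsWeaklyZeroGluing ∧ 𝒳.HasWeaklyDenseHomoclinicPoints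

/-- The class `ℭ₃`: all the acting groups are residually finite. -/
def classThree : EvolutionClass.{u, v} := fun 𝒳 f =>
  classTwo 𝒳 f ∧ ∀ t, Group.ResiduallyFinite (𝒳.Grp t)

/-- The class `ℭ₄`: there is a single tier. -/
def classFour : EvolutionClass.{u, v} := fun 𝒳 f =>
  classTwo 𝒳 f ∧ Subsingleton 𝒳.Tier

/-- `G` is nil-rigid on the class `ℭ`: for every tiered system with base group `G` (up to isomorphism),
every asymptotically nilpotent evolution map that puts the system in `ℭ` is nilpotent on each tier. -/
def IsNilRigidOn (ℭ : EvolutionClass.{u, v}) (G : Type u) [Group G] : Prop :=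
  ∀ 𝒳 : TieredSystem.{u, v}, Nonempty (𝒳.Grp ⊥ ≃* G) →
    ∀ f : 𝒳.Space → 𝒳.Space, 𝒳.IsEvolution f → ℭ 𝒳 f →
      IsAsymptoticallyNilpotent 𝒳.zero f → ∀ t, IsNilpotentMapOn 𝒳.zero f (𝒳.set t)

/-- Every finitely generated subgroup of `G` is nil-rigid on `ℭ`. -/
def IsLocallyNilRigidOn (ℭ : EvolutionClass.{u, v}) (G : Type u) [Group G] : Prop :=
  ∀ H : Subgroup G, H.FG → IsNilRigidOn ℭ H

/-! By expansivity, a point is determined by approximate knowledge of its orbit, so an endomorphism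
acts like a cellular automaton with a finite memory set, and `supp x`, the set of group elements
moving `x` away from `o`, spreads at bounded speed. Gluing lets points with separated supports be
added. If one summand dies by time `T`, before interacting with the other, then from time `T` on the
sum evolves exactly like the other summand (`Superposes.iterate_eq`).

The core is to show that every homoclinic point `y` is mortal, that is, some iterate sends it to
`o`. A subgroup `N` confines if all sums of translates of `y` over sparse subsets of `N` keep their
supports, at all times, in one finite union of cosets `F * N`. The whole group confines trivially.
If the trivial subgroup confines, the orbit of `y` is supported on a fixed finite set, where
pointwise convergence to `o` is uniform, so `y` is mortal. Between these extremes one descends along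
the series. Confinement passes to a finitely generated subgroup, to finite index subgroups, and to
the kernel of a homomorphism onto ℤ (`Confines.ker`). These moves are enough to cross a locally
virtually abelian factor.

The kernel step views the homomorphism as a height and rests on Baire category: in any family of
configurations, some member has all its neighbours in the family attracted to `o` from a common time
on. If sums over the kernel reached arbitrary heights, such a late far-reaching event could be
superposed on that member without changing it much, contradicting the uniform attraction. The
superposition requires the member to be mortal, so configurations of bounded height periodic under a
finite index subgroup are treated beforehand (`Admissible.exists_iterate_eq_o`). That proof is a
second Baire argument, helped by walls: patterns whose neighbourhood evolves independently of
everything else. Residual finiteness supplies the periodic configurations.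

Once homoclinic points are mortal, a third Baire argument makes `o` stable on each tier
(`exists_stable_ball`), and compactness with expansivity upgrades this to nilpotency. For the
local-to-global statements, one restricts to points supported on the subgroup generated by the
memory set and the gluing set (`IsNilRigidOnSystems.of_fg`). -/

open scoped Pointwise

/-! ### Two compactness principles -/

/-- Baire category: an asymptotically nilpotent map attracts, uniformly, some relatively open part of
any given nonempty set. -/
theorem IsAsymptoticallyNilpotent.exists_uniformly_attracted {X : Type*} [MetricSpace X]
    [CompactSpace X] {f : X → X} {o : X} (hnil : IsAsymptoticallyNilpotent o f) (hf : Continuous f)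
    {C : Set X} (hC : C.Nonempty) {ε : ℝ} (hε : 0 < ε) :
    ∃ x ∈ C, ∃ ρ > (0 : ℝ), ∃ J : ℕ, ∀ x' ∈ C, dist x' x < ρ → ∀ M ≥ J, dist (f^[M] x') o < ε := by
  have hcl : IsClosed (closure C) := isClosed_closure
  have : CompactSpace (closure C) := isCompact_iff_compactSpace.mp hcl.isCompact
  have : Nonempty (closure C) := hC.closure.to_subtype
  -- `C` need not be closed, so Baire is applied to its closure. The non-strict bound by `ε / 2`
  -- makes these sets closed while leaving room for the strict bound by `ε`.
  let F : ℕ → Set (closure C) := fun n => {x | ∀ M ≥ n, dist (f^[M] (x : X)) o ≤ ε / 2}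
  have hFc : ∀ n, IsClosed (F n) := by
    intro n
    have : F n = ⋂ M ≥ n, {x : closure C | dist (f^[M] (x : X)) o ≤ ε / 2} := by
      ext x; simp [F]
    rw [this]
    refine isClosed_iInter fun M => isClosed_iInter fun _ => ?_
    exact isClosed_le (((hf.iterate M).comp continuous_subtype_val).dist continuous_const)
      continuous_const
  have hFU : ⋃ n, F n = Set.univ := by
    refine Set.eq_univ_of_forall fun x => Set.mem_iUnion.mpr ?_
    obtain ⟨n, hn⟩ := Metric.tendsto_atTop.mp (hnil x) (ε / 2) (half_pos hε)
    exact ⟨n, fun M hM => (hn M hM).le⟩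
  obtain ⟨n, z, hz⟩ := nonempty_interior_of_iUnion_of_closed hFc hFU
  obtain ⟨ρ, hρ, hball⟩ := Metric.isOpen_iff.mp isOpen_interior z hz
  obtain ⟨x, hxC, hx⟩ := Metric.mem_closure_iff.mp z.2 (ρ / 2) (half_pos hρ)
  refine ⟨x, hxC, ρ / 2, half_pos hρ, n, fun x' hx' hd M hM => ?_⟩
  have hmem : (⟨x', subset_closure hx'⟩ : closure C) ∈ F n := by
    refine interior_subset (hball ?_)
    rw [Metric.mem_ball, Subtype.dist_eq]
    have := dist_triangle x' x (z : X)
    rw [dist_comm (z : X) x] at hx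
    change dist x' (z : X) < ρ
    linarith
  exact (hmem M hM).trans_lt (half_lt_self hε)

/-- In an expansive action on a compact space, closeness is detected on a finite window. -/
theorem exists_finite_expansivity_window {G X : Type*} [Group G] [MetricSpace X] [CompactSpace X]
    [MulAction G X] [ContinuousConstSMul G X] {Δ : ℝ}
    (hexp : ∀ x y : X, (∀ g : G, dist (g • x) (g • y) ≤ Δ) → x = y) {ε : ℝ} (hε : 0 < ε) :
    ∃ F : Set G, F.Finite ∧ ∀ x y : X, (∀ h ∈ F, dist (h • x) (h • y) ≤ Δ) → dist x y < ε := by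
  let s : Set (X × X) := {p | ε ≤ dist p.1 p.2}
  have hs : IsCompact s :=
    (isClosed_le continuous_const (continuous_fst.dist continuous_snd)).isCompact
  obtain ⟨t, ht⟩ := hs.elim_finite_subfamily_closed
    (fun g : G => {p : X × X | dist (g • p.1) (g • p.2) ≤ Δ})
    (fun g => isClosed_le ((continuous_fst.const_smul g).dist (continuous_snd.const_smul g))
      continuous_const) (by
      ext p
      simp only [Set.mem_inter_iff, Set.mem_iInter, Set.mem_ofPred_eq, Set.mem_empty_iff_false,
        iff_false, not_and, s]
      intro hp h
      have := hexp _ _ h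
      rw [this, dist_self] at hp
      linarith)
  refine ⟨t, t.finite_toSet, fun x y h => ?_⟩
  by_contra hcon
  have : (x, y) ∈ s ∩ ⋂ i ∈ t, {p : X × X | dist (i • p.1) (i • p.2) ≤ Δ} := by
    refine ⟨not_lt.mp hcon, ?_⟩
    simp only [Set.mem_iInter, Set.mem_ofPred_eq]
    exact fun i hi => h i hi
  rw [ht] at this
  exact this

theorem IsAsymptoticallyNilpotent.map_zero {X : Type*} [MetricSpace X] {f : X → X} {o : X}
    (hnil : IsAsymptoticallyNilpotent o f) (hf : Continuous f) : f o = o := by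
  have h1 : Tendsto (fun n => f (f^[n] o)) atTop (𝓝 (f o)) := (hf.tendsto o).comp (hnil o)
  have h2 : Tendsto (fun n => f^[n + 1] o) atTop (𝓝 o) :=
    (hnil o).comp (tendsto_add_atTop_nat 1)
  simp only [Function.iterate_succ_apply'] at h2
  exact tendsto_nhds_unique h1 h2

/-! ### Endomorphisms with a finite memory -/

/-- An asymptotically nilpotent endomorphism `f` of an expansive pointed system, with a scale `η` such
that `4 * η` is an expansivity constant, and a finite memory set `E` at that scale. -/
structure LocalEndo (G : Type u) (X : Type v) [Group G] [MetricSpace X] [MulAction G X] where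
  /-- the special point -/
  o : X
  /-- the endomorphism -/
  f : X → X
  /-- the scale -/
  η : ℝ
  /-- the memory set -/
  E : Set G
  η_pos : 0 < η
  smul_o : ∀ g : G, g • o = o
  eq_of_close : ∀ x y : X, (∀ g : G, dist (g • x) (g • y) ≤ 4 * η) → x = y
  continuous_f : Continuous f
  map_smul : ∀ (g : G) (x : X), f (g • x) = g • f x
  nil : IsAsymptoticallyNilpotent o f
  finite_E : E.Finite
  one_mem_E : (1 : G) ∈ E
  memory : ∀ x y : X, (∀ e ∈ E, dist (e • x) (e • y) ≤ 4 * η) → dist (f x) (f y) ≤ η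

namespace LocalEndo

variable {G : Type u} {X : Type v} [Group G] [MetricSpace X] [MulAction G X]

theorem exists_of_expansive [CompactSpace X] [ContinuousConstSMul G X] {o : X} {f : X → X} {η : ℝ}
    (hη : 0 < η) (ho : ∀ g : G, g • o = o)
    (hexp : ∀ x y : X, (∀ g : G, dist (g • x) (g • y) ≤ 4 * η) → x = y) (hf : Continuous f)
    (hfg : ∀ (g : G) (x : X), f (g • x) = g • f x) (hnil : IsAsymptoticallyNilpotent o f) :
    ∃ c : LocalEndo G X, c.o = o ∧ c.f = f ∧ c.η = η := by
  obtain ⟨δ, hδ, hu⟩ := Metric.uniformContinuous_iff.mp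
    (CompactSpace.uniformContinuous_of_continuous hf) η hη
  obtain ⟨F, hF, hw⟩ := exists_finite_expansivity_window hexp hδ
  exact ⟨⟨o, f, η, insert 1 F, hη, ho, hexp, hf, hfg, hnil, hF.insert 1, Set.mem_insert _ _,
    fun x y h => (hu (hw x y fun e he => h e (Set.mem_insert_of_mem _ he))).le⟩, rfl, rfl, rfl⟩

variable (c : LocalEndo G X)

/-- The set of group elements that move `x` away from the special point. -/
def supp (x : X) : Set G := {g | c.η < dist (g • x) c.o}

variable {c}

theorem notMem_supp {x : X} {g : G} : g ∉ c.supp x ↔ dist (g • x) c.o ≤ c.η := by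
  simp [supp]

theorem mem_supp_smul {x : X} {g h : G} : g ∈ c.supp (h • x) ↔ g * h ∈ c.supp x := by
  simp [supp, mul_smul]

theorem η_nonneg : 0 ≤ c.η := c.η_pos.le

theorem map_o : c.f c.o = c.o := c.nil.map_zero c.continuous_f

theorem iterate_o (j : ℕ) : c.f^[j] c.o = c.o := Function.iterate_fixed map_o j

theorem iterate_smul (j : ℕ) (g : G) (x : X) : c.f^[j] (g • x) = g • c.f^[j] x := by
  induction j generalizing x with
  | zero => rfl
  | succ j ih => rw [Function.iterate_succ_apply, c.map_smul, ih, Function.iterate_succ_apply]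

theorem iterate_eq_o_of_le {x : X} {T j : ℕ} (hT : c.f^[T] x = c.o) (hj : T ≤ j) :
    c.f^[j] x = c.o := by
  obtain ⟨k, rfl⟩ := Nat.exists_eq_add_of_le' hj
  rw [Function.iterate_add_apply, hT, iterate_o]

theorem supp_o : c.supp c.o = ∅ := by
  ext g
  simpa [c.smul_o, supp] using (η_nonneg (c := c))

theorem eq_o_of_supp_eq_empty {x : X} (h : ∀ g, g ∉ c.supp x) : x = c.o := by
  refine c.eq_of_close _ _ fun g => ?_
  have := notMem_supp.mp (h g)
  rw [c.smul_o]
  linarith [c.η_pos]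

theorem dist_smul_map_le {x y : X} {g : G}
    (h : ∀ e ∈ c.E, dist ((e * g) • x) ((e * g) • y) ≤ 4 * c.η) :
    dist (g • c.f x) (g • c.f y) ≤ c.η := by
  rw [← c.map_smul, ← c.map_smul]
  exact c.memory _ _ fun e he => by simpa [mul_smul] using h e he

theorem dist_smul_map_o_le {x : X} {g : G}
    (h : ∀ e ∈ c.E, dist ((e * g) • x) c.o ≤ 4 * c.η) :
    dist (g • c.f x) c.o ≤ c.η := by
  have := dist_smul_map_le (c := c) (x := x) (y := c.o) (g := g) fun e he => by
    rw [c.smul_o]; exact h e he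
  rwa [map_o, c.smul_o] at this

theorem pow_E_finite (j : ℕ) : (c.E ^ j).Finite := by
  induction j with
  | zero => simp
  | succ j ih => rw [pow_succ]; exact ih.mul c.finite_E

theorem pow_E_mono {i j : ℕ} (h : i ≤ j) : c.E ^ i ⊆ c.E ^ j :=
  Set.pow_subset_pow_right c.one_mem_E h

theorem dist_smul_iterate_le {x y : X} {j : ℕ} {g : G}
    (h : ∀ k ∈ c.E ^ j, dist ((k * g) • x) ((k * g) • y) ≤ 4 * c.η) :
    dist (g • c.f^[j] x) (g • c.f^[j] y) ≤ 4 * c.η := by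
  induction j generalizing g with
  | zero => simpa using h 1 (by simp)
  | succ j ih =>
    rw [Function.iterate_succ_apply', Function.iterate_succ_apply']
    refine (dist_smul_map_le fun e he => ih fun k hk => ?_).trans (by linarith [c.η_pos])
    rw [← mul_assoc]
    exact h _ (by rw [pow_succ]; exact Set.mul_mem_mul hk he)

/-- Finite speed of propagation: each step enlarges the support by at most a factor `E⁻¹` on the
left. -/
theorem exists_mem_supp_of_iterate {x : X} {j : ℕ} {g : G} (hg : g ∈ c.supp (c.f^[j] x)) :
    ∃ k ∈ c.E ^ j, k * g ∈ c.supp x := by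
  induction j generalizing g with
  | zero => exact ⟨1, by simp, by simpa using hg⟩
  | succ j ih =>
    by_contra hcon
    push Not at hcon
    rw [Function.iterate_succ_apply'] at hg
    refine notMem_supp.mpr (dist_smul_map_o_le fun e he => ?_) hg
    have : e * g ∉ c.supp (c.f^[j] x) := by
      intro h
      obtain ⟨k, hk, hkx⟩ := ih h
      refine hcon (k * e) (by rw [pow_succ]; exact Set.mul_mem_mul hk he) ?_
      rwa [mul_assoc]
    exact (notMem_supp.mp this).trans (by linarith [c.η_pos])

/-- A point whose orbit under `f` is supported on finitely many cosets of its stabilizer is mortal. -/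
theorem exists_iterate_eq_o [ContinuousConstSMul G X] {x : X} {V : Set G} (hV : V.Finite)
    (h : ∀ j, ∀ g ∈ c.supp (c.f^[j] x), ∃ v ∈ V, ∃ s : G, s • x = x ∧ g = v * s) :
    ∃ n, c.f^[n] x = c.o := by
  have hev : ∀ᶠ n in atTop, ∀ v ∈ V, dist (v • c.f^[n] x) c.o < c.η := by
    rw [hV.eventually_all]
    intro v _
    have : Tendsto (fun n => v • c.f^[n] x) atTop (𝓝 (v • c.o)) := (c.nil x).const_smul v
    rw [c.smul_o] at this
    exact (Metric.tendsto_nhds.mp this) c.η c.η_pos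
  obtain ⟨n, hn⟩ := hev.exists
  refine ⟨n, eq_o_of_supp_eq_empty fun g hg => ?_⟩
  obtain ⟨v, hv, s, hs, rfl⟩ := h n g hg
  have h1 := hn v hv
  rw [← hs, iterate_smul, ← mul_smul] at h1
  exact absurd hg (notMem_supp.mpr h1.le)

variable (c) in
/-- `x'` looks like `x` where `w` vanishes, and like `w` where `x` vanishes. -/
def Superposes (x w x' : X) : Prop :=
  (∀ g ∉ c.supp w, dist (g • x') (g • x) ≤ 4 * c.η) ∧
    ∀ g ∉ c.supp x, dist (g • x') (g • w) ≤ 4 * c.η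

/-- Each memory window sees only one of the two points, so there `f x'` copies that point's image.
Errors do not accumulate: memory brings `4η` back to `η`, and at most two further errors `η` come
from replacing one negligible point by another. -/
theorem Superposes.map {x w x' : X} (h : c.Superposes x w x')
    (hsep : ∀ g, (∀ e ∈ c.E, e * g ∉ c.supp x) ∨ ∀ e ∈ c.E, e * g ∉ c.supp w) :
    c.Superposes (c.f x) (c.f w) (c.f x') := by
  have hη := c.η_pos
  have vanish : ∀ {z : X} {g : G}, (∀ e ∈ c.E, e * g ∉ c.supp z) → dist (g • c.f z) c.o ≤ c.η :=
    fun hz => dist_smul_map_o_le fun e he => (notMem_supp.mp (hz e he)).trans (by linarith)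
  refine ⟨fun g hg => ?_, fun g hg => ?_⟩ <;> rw [notMem_supp] at hg
  · rcases hsep g with hx | hw
    · have h1 := dist_smul_map_le (c := c) (x := x') (y := w) (g := g) fun e he => h.2 _ (hx e he)
      have h2 := vanish hx
      have h3 := dist_triangle (g • c.f x') (g • c.f w) (g • c.f x)
      have h4 := dist_triangle_right (g • c.f w) (g • c.f x) c.o
      linarith
    · exact (dist_smul_map_le fun e he => h.1 _ (hw e he)).trans (by linarith)
  · rcases hsep g with hx | hw
    · exact (dist_smul_map_le fun e he => h.2 _ (hx e he)).trans (by linarith)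
    · have h1 := dist_smul_map_le (c := c) (x := x') (y := x) (g := g) fun e he => h.1 _ (hw e he)
      have h2 := vanish hw
      have h3 := dist_triangle (g • c.f x') (g • c.f x) (g • c.f w)
      have h4 := dist_triangle_right (g • c.f x) (g • c.f w) c.o
      linarith

/-- If the supports of `x` and `w` are far apart compared to the time `T` that `x` takes to die, then
from that time on a superposition of `x` and `w` evolves like `w`. -/
theorem Superposes.iterate_eq {x w x' : X} (h : c.Superposes x w x') {T : ℕ}
    (hfar : ∀ a ∈ c.supp x, ∀ b ∈ c.supp w, ∀ k ∈ c.E ^ T, ∀ k' ∈ c.E ^ T, k⁻¹ * a ≠ k'⁻¹ * b)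
    (hT : c.f^[T] x = c.o) {j : ℕ} (hj : T ≤ j) : c.f^[j] x' = c.f^[j] w := by
  have key : ∀ i ≤ T, c.Superposes (c.f^[i] x) (c.f^[i] w) (c.f^[i] x') := by
    intro i
    induction i with
    | zero => exact fun _ => h
    | succ i ih =>
      intro hi
      simp only [Function.iterate_succ_apply']
      refine (ih (by omega)).map fun g => ?_
      by_contra hcon
      push Not at hcon
      obtain ⟨⟨e, he, hx⟩, e', he', hw⟩ := hcon
      obtain ⟨k, hk, hkx⟩ := exists_mem_supp_of_iterate hx
      obtain ⟨k', hk', hkw⟩ := exists_mem_supp_of_iterate hw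
      refine hfar _ hkx _ hkw (k * e) ?_ (k' * e') ?_ (by group)
      · exact pow_E_mono hi (by rw [pow_succ]; exact Set.mul_mem_mul hk he)
      · exact pow_E_mono hi (by rw [pow_succ]; exact Set.mul_mem_mul hk' he')
  have hTw : c.f^[T] x' = c.f^[T] w := by
    refine c.eq_of_close _ _ fun g => (key T le_rfl).2 g ?_
    rw [hT, supp_o]
    exact Set.notMem_empty g
  obtain ⟨k, rfl⟩ := Nat.exists_eq_add_of_le' hj
  rw [Function.iterate_add_apply, hTw, ← Function.iterate_add_apply]

end LocalEndo

/-! ### Approximate addition, and sums of translates of one point. -/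

/-! ### Sums of points with separated supports -/

namespace LocalEndo

variable {G : Type u} {X : Type v} [Group G] [MetricSpace X] [MulAction G X] (c : LocalEndo G X)

/-- The `D`-neighbourhoods of the supports of the points `x i` are disjoint. -/
def Separated (D : Set G) {I : Type u} (x : I → X) : Prop :=
  ∀ i j g, g ∈ D * c.supp (x i) → g ∈ D * c.supp (x j) → i = j

/-- `z` is close to `x i` on the `D`-neighbourhood of the support of `x i`, and vanishes elsewhere. -/
def IsSum (D : Set G) {I : Type u} (x : I → X) (z : X) : Prop :=
  (∀ i, ∀ g ∈ D * c.supp (x i), dist (g • z) (g • x i) ≤ c.η) ∧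
    ∀ g, (∀ i, g ∉ D * c.supp (x i)) → dist (g • z) c.o ≤ c.η

variable {c}

/-- This is how a far-away disturbance `w` is added to a point chosen by Baire category while
remaining within the same family of sums. -/
theorem IsSum.superposes_option {D : Set G} (hD : (1 : G) ∈ D) {I : Type u} {x : I → X} {z w z' : X}
    (hz : c.IsSum D x z) (hz' : c.IsSum D (fun i : Option I => i.elim w x) z') :
    c.Superposes z w z' := by
  have hη := c.η_pos
  have hsub : ∀ {y : X} {g : G}, g ∈ c.supp y → g ∈ D * c.supp y :=
    fun hg => ⟨1, hD, _, hg, one_mul _⟩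
  refine ⟨fun g hg => ?_, fun g hg => ?_⟩
  · by_cases h : ∃ i, g ∈ D * c.supp (x i)
    · obtain ⟨i, hi⟩ := h
      have h1 := hz.1 i g hi
      have h2 := hz'.1 (some i) g hi
      have h3 := dist_triangle_right (g • z') (g • z) (g • x i)
      simp only [Option.elim_some] at h2
      linarith
    · push Not at h
      have h1 := hz.2 g h
      have h3 := dist_triangle_right (g • z') (g • z) c.o
      by_cases hw : g ∈ D * c.supp w
      · have h2 := hz'.1 none g hw
        simp only [Option.elim_none] at h2
        have h4 := dist_triangle (g • z') (g • w) c.o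
        have h5 := notMem_supp.mp hg
        linarith
      · have h2 := hz'.2 g (by rintro (_ | i); exacts [hw, h i])
        linarith
  · rw [notMem_supp] at hg
    by_cases hw : g ∈ D * c.supp w
    · have h2 := hz'.1 none g hw
      simp only [Option.elim_none] at h2
      linarith
    · have h5 : dist (g • w) c.o ≤ c.η := notMem_supp.mp fun h => hw (hsub h)
      have h3 := dist_triangle_right (g • z') (g • w) c.o
      by_cases h : ∃ i, g ∈ D * c.supp (x i)
      · obtain ⟨i, hi⟩ := h
        have h1 := hz.1 i g hi
        have h2 := hz'.1 (some i) g hi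
        simp only [Option.elim_some] at h2
        have h4 := dist_triangle_right (g • z') (g • z) (g • x i)
        have h6 := dist_triangle (g • z') (g • z) c.o
        linarith
      · push Not at h
        have h2 := hz'.2 g (by rintro (_ | i); exacts [hw, h i])
        linarith

end LocalEndo

/-- A local endomorphism together with a point `y`, the sums `Y A` of the translates `a⁻¹ • y`, `a ∈ A`,
over all sparse sets `A` (those whose translates `Q * a` are disjoint), and an invariant set `S` that
contains these sums and whose separated families have sums. -/
structure SumSystem (G : Type u) (X : Type v) [Group G] [MetricSpace X] [MulAction G X] extends
    LocalEndo G X where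
  /-- the point whose translates are added up -/
  y : X
  /-- a neighbourhood of the support of `y` -/
  Q : Set G
  /-- the separation needed for sums of points of `S` -/
  D : Set G
  /-- the invariant set -/
  S : Set X
  /-- the sum of the translates of `y` over a sparse set -/
  Y : Set G → X
  finite_Q : Q.Finite
  Y_mem : ∀ A : Set G, (∀ a ∈ A, ∀ b ∈ A, ∀ g, g * a⁻¹ ∈ Q → g * b⁻¹ ∈ Q → a = b) → Y A ∈ S
  Y_near : ∀ A : Set G, (∀ a ∈ A, ∀ b ∈ A, ∀ g, g * a⁻¹ ∈ Q → g * b⁻¹ ∈ Q → a = b) →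
    ∀ a ∈ A, ∀ g, g * a⁻¹ ∈ Q → dist (g • Y A) (g • a⁻¹ • y) ≤ η
  Y_far : ∀ A : Set G, (∀ a ∈ A, ∀ b ∈ A, ∀ g, g * a⁻¹ ∈ Q → g * b⁻¹ ∈ Q → a = b) →
    ∀ g, (∀ a ∈ A, g * a⁻¹ ∉ Q) → dist (g • Y A) o ≤ η
  supp_y : ∀ g, η < dist (g • y) o → g ∈ Q
  smul_mem : ∀ x ∈ S, ∀ g : G, g • x ∈ S
  map_mem : ∀ x ∈ S, f x ∈ S
  finite_D : D.Finite
  one_mem_D : (1 : G) ∈ D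
  exists_isSum : ∀ (I : Type u) (x : I → X), (∀ i, x i ∈ S) → toLocalEndo.Separated D x →
    ∃ z, toLocalEndo.IsSum D x z

namespace SumSystem

open LocalEndo

variable {G : Type u} {X : Type v} [Group G] [MetricSpace X] [MulAction G X] (c : SumSystem G X)

/-- The translates `Q * a`, `a ∈ A`, are disjoint. -/
def Sparse (A : Set G) : Prop :=
  ∀ a ∈ A, ∀ b ∈ A, ∀ g, g * a⁻¹ ∈ c.Q → g * b⁻¹ ∈ c.Q → a = b

variable {c}

theorem Sparse.mono {A B : Set G} (hB : c.Sparse B) (h : A ⊆ B) : c.Sparse A :=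
  fun a ha b hb => hB a (h ha) b (h hb)

theorem sparse_empty : c.Sparse ∅ := fun _ h => h.elim

theorem sparse_singleton (g : G) : c.Sparse {g} := by
  rintro a rfl b rfl _ _ _; rfl

theorem Sparse.translate {A : Set G} (hA : c.Sparse A) (h : G) : c.Sparse {n | n * h ∈ A} := by
  intro a ha b hb g hga hgb
  have := hA _ ha _ hb (g * h) (by simpa [mul_assoc] using hga) (by simpa [mul_assoc] using hgb)
  exact mul_right_cancel this

theorem iterate_mem {x : X} (hx : x ∈ c.S) (j : ℕ) : c.f^[j] x ∈ c.S := by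
  induction j with
  | zero => exact hx
  | succ j ih => rw [Function.iterate_succ_apply']; exact c.map_mem _ ih

theorem dist_smul_Y_le {A B : Set G} (hA : c.Sparse A) (hB : c.Sparse B) {g : G}
    (h : ∀ a, g * a⁻¹ ∈ c.Q → (a ∈ A ↔ a ∈ B)) : dist (g • c.Y A) (g • c.Y B) ≤ 2 * c.η := by
  by_cases hex : ∃ a ∈ A, g * a⁻¹ ∈ c.Q
  · obtain ⟨a, ha, hga⟩ := hex
    have h1 := c.Y_near A hA a ha g hga
    have h2 := c.Y_near B hB a ((h a hga).mp ha) g hga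
    have h3 := dist_triangle_right (g • c.Y A) (g • c.Y B) (g • a⁻¹ • c.y)
    linarith
  · push Not at hex
    have h1 := c.Y_far A hA g hex
    have h2 := c.Y_far B hB g fun a ha hga => hex a ((h a hga).mpr ha) hga
    have h3 := dist_triangle_right (g • c.Y A) (g • c.Y B) c.o
    linarith

/-- `Y` is an arbitrary choice of approximate sums, but two sums over the same translates stay
`2η`-close along the whole orbit, so expansivity forces equivariance. -/
theorem smul_Y {A : Set G} (hA : c.Sparse A) (h : G) : h • c.Y A = c.Y {n | n * h ∈ A} := by
  have hη := c.η_pos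
  refine c.eq_of_close _ _ fun g => ?_
  rw [← mul_smul]
  by_cases hex : ∃ a ∈ A, (g * h) * a⁻¹ ∈ c.Q
  · obtain ⟨a, ha, hga⟩ := hex
    have h1 := c.Y_near A hA a ha (g * h) hga
    have h2 := c.Y_near _ (hA.translate h) (a * h⁻¹) (by simpa using ha) g
      (by simpa [mul_assoc] using hga)
    have h4 : g • (a * h⁻¹)⁻¹ • c.y = (g * h) • a⁻¹ • c.y := by simp [mul_smul]
    rw [h4] at h2
    have h3 := dist_triangle_right ((g * h) • c.Y A) (g • c.Y {n | n * h ∈ A})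
      ((g * h) • a⁻¹ • c.y)
    linarith
  · push Not at hex
    have h1 := c.Y_far A hA _ hex
    have h2 := c.Y_far _ (hA.translate h) g fun a ha hga =>
      hex (a * h) ha (by simpa [mul_assoc] using hga)
    have h3 := dist_triangle_right ((g * h) • c.Y A) (g • c.Y {n | n * h ∈ A}) c.o
    linarith

theorem smul_Y_of_invariant {A : Set G} (hA : c.Sparse A) {h : G} (hh : ∀ n, n * h ∈ A ↔ n ∈ A) :
    h • c.Y A = c.Y A := by
  rw [smul_Y hA]
  congr 1
  ext n
  exact hh n

theorem Y_one : c.Y {1} = c.y := by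
  have hη := c.η_pos
  refine c.eq_of_close _ _ fun g => ?_
  by_cases hg : g ∈ c.Q
  · have := c.Y_near {1} (sparse_singleton 1) 1 rfl g (by simpa using hg)
    simp only [inv_one, one_smul] at this
    linarith
  · have h1 := c.Y_far {1} (sparse_singleton 1) g (by rintro a rfl; simpa using hg)
    have h2 : dist (g • c.y) c.o ≤ c.η := by
      by_contra hcon
      exact hg (c.supp_y g (not_le.mp hcon))
    have h3 := dist_triangle_right (g • c.Y {1}) (g • c.y) c.o
    linarith

theorem exists_of_mem_supp_Y {A : Set G} (hA : c.Sparse A) {g : G} (hg : g ∈ c.supp (c.Y A)) :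
    ∃ a ∈ A, g * a⁻¹ ∈ c.Q := by
  by_contra hcon
  push Not at hcon
  exact notMem_supp.mpr (c.Y_far A hA g hcon) hg

theorem exists_of_mem_supp_iterate_Y {A : Set G} (hA : c.Sparse A) {j : ℕ} {g : G}
    (hg : g ∈ c.supp (c.f^[j] (c.Y A))) : ∃ k ∈ c.E ^ j, ∃ q ∈ c.Q, ∃ a ∈ A, g = k⁻¹ * (q * a) := by
  obtain ⟨k, hk, hkg⟩ := exists_mem_supp_of_iterate hg
  obtain ⟨a, ha, hq⟩ := exists_of_mem_supp_Y hA hkg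
  exact ⟨k, hk, _, hq, a, ha, by group⟩

theorem superposes_union {A B : Set G} (h : c.Sparse (A ∪ B)) :
    c.Superposes (c.Y A) (c.Y B) (c.Y (A ∪ B)) := by
  have hη := c.η_pos
  have key : ∀ {A B : Set G}, c.Sparse (A ∪ B) → ∀ g ∉ c.supp (c.Y B),
      dist (g • c.Y (A ∪ B)) (g • c.Y A) ≤ 4 * c.η := by
    intro A B h g hg
    have hA : c.Sparse A := h.mono Set.subset_union_left
    have hB : c.Sparse B := h.mono Set.subset_union_right
    rw [notMem_supp] at hg
    by_cases hexA : ∃ a ∈ A, g * a⁻¹ ∈ c.Q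
    · obtain ⟨a, ha, hga⟩ := hexA
      have h1 := c.Y_near A hA a ha g hga
      have h2 := c.Y_near _ h a (Or.inl ha) g hga
      have h3 := dist_triangle_right (g • c.Y (A ∪ B)) (g • c.Y A) (g • a⁻¹ • c.y)
      linarith
    · push Not at hexA
      have h1 := c.Y_far A hA g hexA
      have h3 := dist_triangle_right (g • c.Y (A ∪ B)) (g • c.Y A) c.o
      by_cases hexB : ∃ b ∈ B, g * b⁻¹ ∈ c.Q
      · obtain ⟨b, hb, hgb⟩ := hexB
        have h2 := c.Y_near _ h b (Or.inr hb) g hgb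
        have h4 := c.Y_near B hB b hb g hgb
        have h5 := dist_triangle_right (g • c.Y (A ∪ B)) (g • c.Y B) (g • b⁻¹ • c.y)
        have h6 := dist_triangle (g • c.Y (A ∪ B)) (g • c.Y B) c.o
        linarith
      · push Not at hexB
        have h2 := c.Y_far _ h g (by rintro a (ha | ha); exacts [hexA a ha, hexB a ha])
        linarith
  refine ⟨key h, ?_⟩
  rw [Set.union_comm] at h ⊢
  exact key h

variable (c) in
/-- Sums over sparse sets depend continuously on the set. -/
theorem exists_window [CompactSpace X] [ContinuousConstSMul G X] {ρ : ℝ} (hρ : 0 < ρ) :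
    ∃ W : Set G, W.Finite ∧ ∀ A B : Set G, c.Sparse A → c.Sparse B →
      (∀ n ∈ W, n ∈ A ↔ n ∈ B) → dist (c.Y A) (c.Y B) < ρ := by
  obtain ⟨F, hF, hw⟩ := exists_finite_expansivity_window c.eq_of_close hρ
  refine ⟨c.Q⁻¹ * F, c.finite_Q.inv.mul hF, fun A B hA hB h => hw _ _ fun g hg => ?_⟩
  refine (dist_smul_Y_le hA hB fun a ha => h a ⟨(g * a⁻¹)⁻¹, by simpa using ha, g, hg, ?_⟩).trans
    (by linarith [c.η_pos])
  group

theorem exists_window_supp [CompactSpace X] [ContinuousConstSMul G X] {A : Set G} (hA : c.Sparse A)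
    {j : ℕ} {g : G} (hg : g ∈ c.supp (c.f^[j] (c.Y A))) :
    ∃ W : Set G, W.Finite ∧ ∀ B : Set G, c.Sparse B → (∀ n ∈ W, n ∈ B ↔ n ∈ A) →
      g ∈ c.supp (c.f^[j] (c.Y B)) := by
  have hopen : IsOpen {x : X | c.η < dist (g • c.f^[j] x) c.o} :=
    isOpen_lt continuous_const (((c.continuous_f.iterate j).const_smul g).dist continuous_const)
  obtain ⟨ρ, hρ, hball⟩ := Metric.isOpen_iff.mp hopen (c.Y A) hg
  obtain ⟨W, hW, h⟩ := c.exists_window hρ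
  exact ⟨W, hW, fun B hB hAB => hball (h B A hB hA hAB)⟩

/-! ### Confinement to a subgroup -/

variable (c) in
/-- Sums over sparse subsets of `N` never leave a fixed finite union of cosets of `N`. -/
def Confines (N : Subgroup G) : Prop :=
  ∃ F : Set G, F.Finite ∧ ∀ A : Set G, c.Sparse A → A ⊆ N → ∀ j,
    c.supp (c.f^[j] (c.Y A)) ⊆ F * (N : Set G)

variable (c) in
theorem confines_top : c.Confines ⊤ :=
  ⟨{1}, Set.finite_singleton 1, fun _ _ _ _ g _ => ⟨1, rfl, g, Set.mem_univ g, one_mul g⟩⟩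

theorem Confines.of_finite_cover {N M : Subgroup G} (hN : c.Confines N) (hM : M ≤ N) {V : Set G}
    (hV : V.Finite) (hcov : ∀ n ∈ N, n ∈ V * (M : Set G)) : c.Confines M := by
  obtain ⟨F, hF, h⟩ := hN
  refine ⟨F * V, hF.mul hV, fun A hA hAM j g hg => ?_⟩
  obtain ⟨φ, hφ, n, hn, rfl⟩ := h A hA (hAM.trans hM) j hg
  obtain ⟨v, hv, m, hm, rfl⟩ := hcov n hn
  exact ⟨φ * v, Set.mul_mem_mul hφ hv, m, hm, mul_assoc _ _ _⟩

theorem Confines.of_relIndex {N M : Subgroup G} (hN : c.Confines N) (hM : M ≤ N)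
    (hfin : (M.subgroupOf N).FiniteIndex) : c.Confines M := by
  have : Finite (N ⧸ M.subgroupOf N) := Subgroup.finite_quotient_of_finiteIndex
  refine hN.of_finite_cover hM
    (Set.finite_range fun q : N ⧸ M.subgroupOf N => ((q.out : N) : G)) fun n hn => ?_
  refine ⟨_, ⟨((⟨n, hn⟩ : N) : N ⧸ M.subgroupOf N), rfl⟩, _, ?_, mul_inv_cancel_left _ _⟩
  have := QuotientGroup.mk_out_eq_mul (M.subgroupOf N) ⟨n, hn⟩
  obtain ⟨m, hm⟩ := this
  have hm' : (((((⟨n, hn⟩ : N) : N ⧸ M.subgroupOf N).out : N) : G)) = n * ((m : N) : G) := by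
    rw [hm]; rfl
  change (((((⟨n, hn⟩ : N) : N ⧸ M.subgroupOf N).out : N) : G))⁻¹ * n ∈ M
  rw [hm']
  have : ((m : N) : G) ∈ M := m.2
  simpa using this

/-- A confining subgroup contains a finitely generated one. -/
theorem Confines.exists_fg {N : Subgroup G} (hN : c.Confines N) :
    ∃ M ≤ N, M.FG ∧ c.Confines M := by
  obtain ⟨F, hF, h⟩ := hN
  set F' : Set G := F ∪ c.Q with hF'
  have hF'fin : F'.Finite := hF.union c.finite_Q
  -- These are the possible increments in `N` when the support moves by one step between the cosets
  -- listed in `F'`. They generate a subgroup that the support cannot leave. Adding `Q` to `F`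
  -- covers time zero.
  set U : Set G := (N : Set G) ∩ (F'⁻¹ * c.E⁻¹ * F') with hU
  have hUfin : U.Finite := ((hF'fin.inv.mul c.finite_E.inv).mul hF'fin).inter_of_right _
  have hle : Subgroup.closure U ≤ N := (Subgroup.closure_le N).mpr Set.inter_subset_left
  refine ⟨Subgroup.closure U, hle, (Subgroup.fg_iff _).mpr ⟨U, rfl, hUfin⟩, F', hF'fin, ?_⟩
  intro A hA hAM j
  induction j with
  | zero =>
    intro g hg
    obtain ⟨a, ha, hq⟩ := exists_of_mem_supp_Y hA hg
    exact ⟨g * a⁻¹, Or.inr hq, a, hAM ha, by simp⟩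
  | succ j ih =>
    intro g hg
    obtain ⟨φ, hφ, n, hn, hgn⟩ := h A hA (hAM.trans hle) (j + 1) hg
    rw [Function.iterate_succ_apply'] at hg
    have : ∃ e ∈ c.E, e * g ∈ c.supp (c.f^[j] (c.Y A)) := by
      obtain ⟨k, hk, hkg⟩ := exists_mem_supp_of_iterate (c := c.toLocalEndo) (j := 1) hg
      exact ⟨k, by simpa using hk, hkg⟩
    obtain ⟨e, he, heg⟩ := this
    obtain ⟨ψ, hψ, m, hm, hgm⟩ := ih heg
    refine ⟨φ, Or.inl hφ, n, ?_, hgn⟩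
    dsimp only at hgn hgm
    have hnm : n * m⁻¹ = φ⁻¹ * e⁻¹ * ψ := by
      have h1 : n = φ⁻¹ * g := by rw [← hgn]; group
      have h2 : m = ψ⁻¹ * (e * g) := by rw [← hgm]; group
      rw [h1, h2]; group
    have hmem : n * m⁻¹ ∈ Subgroup.closure U := by
      refine Subgroup.subset_closure ⟨N.mul_mem hn (N.inv_mem (hle hm)), ?_⟩
      rw [hnm]
      exact Set.mul_mem_mul (Set.mul_mem_mul (Set.inv_mem_inv.mpr (Or.inl hφ))
        (Set.inv_mem_inv.mpr he)) hψ
    simpa using (Subgroup.closure U).mul_mem hmem hm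

/-- Here `F * ⊥` is just the finite set `F`, so no stabilizer is needed. -/
theorem Confines.exists_iterate_y_eq_o [ContinuousConstSMul G X] (h : c.Confines ⊥) :
    ∃ n, c.f^[n] c.y = c.o := by
  obtain ⟨F, hF, h⟩ := h
  refine exists_iterate_eq_o hF fun j g hg => ⟨g, ?_, 1, one_smul _ _, (mul_one g).symm⟩
  rw [← Y_one] at hg
  obtain ⟨φ, hφ, n, hn, rfl⟩ := h {1} (sparse_singleton 1) (by simp) j hg
  simp only [Subgroup.coe_bot, Set.mem_singleton_iff] at hn
  simpa [hn] using hφ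

end SumSystem

theorem Set.Finite.exists_abs_le {α : Type*} {s : Set α} (hs : s.Finite) (φ : α → ℤ) :
    ∃ r : ℤ, 0 ≤ r ∧ ∀ a ∈ s, |φ a| ≤ r := by
  obtain ⟨r, hr⟩ := (hs.image fun a => |φ a|).bddAbove
  exact ⟨max r 0, le_max_right _ _, fun a ha => (hr ⟨a, ha, rfl⟩).trans (le_max_left _ _)⟩

/-! ### Height functions -/

/-- A height function on `G` for a subgroup `N`: it restricts to a surjective homomorphism `N → ℤ`, and
is equivariant for right multiplication by `N`. -/
structure Height {G : Type u} [Group G] (N : Subgroup G) where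
  /-- the height -/
  ht : G → ℤ
  /-- an element of height one -/
  τ : G
  τ_mem : τ ∈ N
  ht_τ : ht τ = 1
  ht_mul : ∀ g, ∀ n ∈ N, ht (g * n) = ht g + ht n

namespace Height

variable {G : Type u} [Group G] {N : Subgroup G} (H : Height N)

theorem ht_one : H.ht 1 = 0 := by
  have := H.ht_mul 1 1 N.one_mem
  rw [mul_one] at this
  linarith

theorem ht_inv {n : G} (hn : n ∈ N) : H.ht n⁻¹ = -H.ht n := by
  have := H.ht_mul n⁻¹ n hn
  rw [inv_mul_cancel, ht_one] at this
  linarith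

theorem ht_zpow (m : ℤ) : H.ht (H.τ ^ m) = m := by
  induction m using Int.induction_on with
  | zero => simpa using H.ht_one
  | succ i ih => rw [zpow_add_one, H.ht_mul _ _ H.τ_mem, ih, H.ht_τ]
  | pred i ih =>
    rw [zpow_sub_one, H.ht_mul _ _ (N.inv_mem H.τ_mem), ih, H.ht_inv H.τ_mem, H.ht_τ]; ring

theorem zpow_mem (m : ℤ) : H.τ ^ m ∈ N := N.zpow_mem H.τ_mem m

theorem ht_mul_zpow (g : G) (m : ℤ) : H.ht (g * H.τ ^ m) = H.ht g + m := by
  rw [H.ht_mul _ _ (H.zpow_mem m), ht_zpow]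

/-- The elements of `N` of height zero. -/
def ker : Subgroup G where
  carrier := {n | n ∈ N ∧ H.ht n = 0}
  mul_mem' := by
    rintro a b ⟨ha, ha0⟩ ⟨hb, hb0⟩
    exact ⟨N.mul_mem ha hb, by rw [H.ht_mul _ _ hb, ha0, hb0, add_zero]⟩
  one_mem' := ⟨N.one_mem, H.ht_one⟩
  inv_mem' := by
    rintro a ⟨ha, ha0⟩
    exact ⟨N.inv_mem ha, by rw [H.ht_inv ha, ha0, neg_zero]⟩

theorem mem_ker {n : G} : n ∈ H.ker ↔ n ∈ N ∧ H.ht n = 0 := Iff.rfl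

theorem ker_le : H.ker ≤ N := fun _ h => h.1

/-- The elements of height zero of `N` that lie in `K`. -/
def per (K : Subgroup G) : Subgroup G := H.ker ⊓ K

variable {K : Subgroup G}

theorem ht_mul_per (g : G) {l : G} (hl : l ∈ H.per K) : H.ht (g * l) = H.ht g := by
  rw [H.ht_mul _ _ hl.1.1, hl.1.2, add_zero]

theorem conj_mem_per [hK : K.Normal] {l : G} (hl : l ∈ H.per K) (m : ℤ) :
    H.τ ^ m * l * H.τ ^ (-m) ∈ H.per K := by
  refine ⟨⟨N.mul_mem (N.mul_mem (H.zpow_mem m) hl.1.1) (H.zpow_mem _), ?_⟩, ?_⟩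
  · rw [ht_mul_zpow, H.ht_mul _ _ hl.1.1, hl.1.2, ht_zpow]; ring
  · rw [zpow_neg]; exact hK.conj_mem l hl.2 _

theorem exists_bound {Φ Ψ : Set G} (hΦ : Φ.Finite) (hΨ : Ψ.Finite) :
    ∃ r : ℤ, 0 ≤ r ∧ ∀ ψ ∈ Ψ, ∀ g ∈ Φ * (N : Set G), |H.ht (ψ * g) - H.ht g| ≤ r := by
  obtain ⟨r, hr, h⟩ := (hΨ.prod hΦ).exists_abs_le fun p => H.ht (p.1 * p.2) - H.ht p.2
  refine ⟨r, hr, ?_⟩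
  rintro ψ hψ _ ⟨φ, hφ, n, hn, rfl⟩
  have := h (ψ, φ) ⟨hψ, hφ⟩
  dsimp only at this ⊢
  rw [← mul_assoc, H.ht_mul _ _ hn, H.ht_mul _ _ hn]
  simpa using this

theorem exists_bound_mem {Ψ : Set G} (hΨ : Ψ.Finite) :
    ∃ r : ℤ, 0 ≤ r ∧ ∀ ψ ∈ Ψ, ∀ n ∈ N, |H.ht (ψ * n) - H.ht n| ≤ r := by
  obtain ⟨r, hr, h⟩ := H.exists_bound (Set.finite_singleton 1) hΨ
  exact ⟨r, hr, fun ψ hψ n hn => h ψ hψ n ⟨1, rfl, n, hn, one_mul n⟩⟩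

/-- Up to `per K`, a union of finitely many cosets of `N` has finitely many elements of each height. -/
theorem exists_decomp (K : Subgroup G) [K.Normal] [K.FiniteIndex] {F : Set G} (hF : F.Finite) :
    ∃ V : Set G, V.Finite ∧ ∀ g ∈ F * (N : Set G), ∃ v ∈ V, ∃ l ∈ H.per K,
      g = v * H.τ ^ (H.ht g - H.ht v) * l := by
  have : Finite (G ⧸ K) := Subgroup.finite_quotient_of_finiteIndex
  -- Only cosets of `K` that meet the kernel need a representative, and it is taken in the kernel;
  -- the others get the dummy value `1`.
  have hrep : ∀ q : G ⧸ K, ∃ v : G, (∃ n ∈ H.ker, (n : G ⧸ K) = q) →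
      v ∈ H.ker ∧ (v : G ⧸ K) = q := by
    intro q
    by_cases h : ∃ n ∈ H.ker, (n : G ⧸ K) = q
    · obtain ⟨n, hn⟩ := h; exact ⟨n, fun _ => hn⟩
    · exact ⟨1, fun h' => absurd h' h⟩
  choose rep hrep using hrep
  refine ⟨F * Set.range rep, hF.mul (Set.finite_range rep), ?_⟩
  rintro _ ⟨φ, hφ, n, hn, rfl⟩
  set m := H.ht n with hm
  have hn' : n * H.τ ^ (-m) ∈ H.ker :=
    ⟨N.mul_mem hn (H.zpow_mem _), by rw [ht_mul_zpow]; ring⟩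
  obtain ⟨hv, hvq⟩ := hrep (n * H.τ ^ (-m) : G) ⟨_, hn', rfl⟩
  set v := rep (n * H.τ ^ (-m) : G) with hvdef
  have hl : v⁻¹ * (n * H.τ ^ (-m)) ∈ H.per K :=
    ⟨H.ker.mul_mem (H.ker.inv_mem hv) hn', QuotientGroup.eq.mp hvq⟩
  refine ⟨φ * v, Set.mul_mem_mul hφ ⟨_, rfl⟩,
    H.τ ^ (-m) * (v⁻¹ * (n * H.τ ^ (-m))) * H.τ ^ (-(-m)), H.conj_mem_per hl (-m), ?_⟩
  have hht : H.ht (φ * n) - H.ht (φ * v) = m := by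
    rw [H.ht_mul _ _ hn, H.ht_mul _ _ hv.1, hv.2]; ring
  dsimp only
  rw [hht]; group

end Height

/-! ### Walls -/

namespace LocalEndo

variable {G : Type u} {X : Type v} [Group G] [MetricSpace X] [MulAction G X]

theorem exists_ball_o [ContinuousConstSMul G X] (c : LocalEndo G X) {V : Set G} (hV : V.Finite) :
    ∃ ε > (0 : ℝ), ∀ x, dist x c.o < ε → ∀ g ∈ V, g ∉ c.supp x := by
  have : ∀ᶠ x in 𝓝 c.o, ∀ g ∈ V, dist (g • x) c.o < c.η := by
    rw [hV.eventually_all]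
    intro g _
    have h : Tendsto (fun x : X => g • x) (𝓝 c.o) (𝓝 (g • c.o)) :=
      (continuous_const_smul g).tendsto c.o
    rw [c.smul_o] at h
    exact Metric.tendsto_nhds.mp h c.η c.η_pos
  obtain ⟨ε, hε, h⟩ := Metric.eventually_nhds_iff.mp this
  exact ⟨ε, hε, fun x hx g hg => notMem_supp.mpr (h hx g hg).le⟩

end LocalEndo

namespace SumSystem

open LocalEndo

variable {G : Type u} {X : Type v} [Group G] [MetricSpace X] [MulAction G X] {c : SumSystem G X}
  {N : Subgroup G} {H : Height N} {K : Subgroup G}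

variable (c H K) in
/-- Sparse subsets of `N` that are invariant under `H.per K`. -/
structure Admissible (A : Set G) : Prop where
  sparse : c.Sparse A
  subset : A ⊆ N
  mul_mem : ∀ a ∈ A, ∀ l ∈ H.per K, a * l ∈ A

theorem admissible_empty : c.Admissible H K ∅ :=
  ⟨sparse_empty, Set.empty_subset _, fun _ h => h.elim⟩

theorem Admissible.smul_Y {A : Set G} (hA : c.Admissible H K A) {l : G} (hl : l ∈ H.per K) :
    l • c.Y A = c.Y A :=
  smul_Y_of_invariant hA.sparse fun n =>
    ⟨fun h => by simpa using hA.mul_mem _ h _ ((H.per K).inv_mem hl), fun h => hA.mul_mem _ h _ hl⟩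

theorem Admissible.translate [K.Normal] {A : Set G} (hA : c.Admissible H K A) (m : ℤ) :
    c.Admissible H K {n | n * H.τ ^ m ∈ A} := by
  refine ⟨hA.sparse.translate _, fun n hn => ?_, fun a ha l hl => ?_⟩
  · have := N.mul_mem (hA.subset hn) (N.inv_mem (H.zpow_mem m))
    simpa using this
  · have := hA.mul_mem _ ha _ (H.conj_mem_per hl (-m))
    change a * l * H.τ ^ m ∈ A
    convert this using 1
    rw [neg_neg, zpow_neg]; group

variable (H) in
/-- Around the height `u`, the set `A` looks like `A₀` around the height `0`. -/
def HasWall (A₀ : Set G) (q : ℤ) (A : Set G) (u : ℤ) : Prop :=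
  ∀ n ∈ N, |H.ht n - u| ≤ q → (n ∈ A ↔ n * H.τ ^ (-u) ∈ A₀)

/-- Two configurations with common walls that agree on the region `I` bounded by these walls evolve in
the same way on `I`. -/
theorem dist_le_of_hasWall {F A₀ A B : Set G} {r q : ℤ}
    (hconf : ∀ A : Set G, c.Sparse A → A ⊆ N → ∀ j, c.supp (c.f^[j] (c.Y A)) ⊆ F * (N : Set G))
    (hr : ∀ e ∈ c.E, ∀ g ∈ F * (N : Set G), |H.ht (e * g) - H.ht g| ≤ r)
    (hq : ∀ g ∈ F * (N : Set G), ∀ a, g * a⁻¹ ∈ c.Q → |H.ht a - H.ht g| ≤ q)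
    (hwall : ∀ A B u, c.Admissible H K A → c.Admissible H K B → HasWall H A₀ q A u →
      HasWall H A₀ q B u → ∀ j, ∀ g ∈ F * (N : Set G), |H.ht g - u| ≤ r →
          dist (g • c.f^[j] (c.Y A)) (g • c.f^[j] (c.Y B)) ≤ 4 * c.η)
    (hA : c.Admissible H K A) (hB : c.Admissible H K B) {I U : Set ℤ}
    (hI : ∀ v ∈ I, (∃ u ∈ U, |v - u| ≤ r) ∨ ∀ v', |v' - v| ≤ r → v' ∈ I)
    (hUA : ∀ u ∈ U, HasWall H A₀ q A u) (hUB : ∀ u ∈ U, HasWall H A₀ q B u)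
    (hAB : ∀ n ∈ N, ∀ v ∈ I, |H.ht n - v| ≤ q → (n ∈ A ↔ n ∈ B)) (j : ℕ) :
    ∀ g ∈ F * (N : Set G), H.ht g ∈ I →
      dist (g • c.f^[j] (c.Y A)) (g • c.f^[j] (c.Y B)) ≤ 4 * c.η := by
  have hη := c.η_pos
  induction j with
  | zero =>
    intro g hg hgI
    refine (dist_smul_Y_le hA.sparse hB.sparse fun a ha => ?_).trans (by linarith)
    by_cases haN : a ∈ N
    · exact hAB a haN _ hgI (hq g hg a ha)
    · exact ⟨fun h => absurd (hA.subset h) haN, fun h => absurd (hB.subset h) haN⟩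
  | succ j ih =>
    intro g hg hgI
    -- Near a boundary wall, the independence property of walls applies at every time. Elsewhere the
    -- memory window stays at heights in `I`, and outside `F * N` both points are negligible.
    rcases hI _ hgI with ⟨u, hu, hgu⟩ | hclosed
    · exact hwall A B u hA hB (hUA u hu) (hUB u hu) (j + 1) g hg hgu
    · rw [Function.iterate_succ_apply', Function.iterate_succ_apply']
      refine (dist_smul_map_le fun e he => ?_).trans (by linarith)
      by_cases heg : e * g ∈ F * (N : Set G)
      · exact ih _ heg (hclosed _ (hr e he g hg))
      · have h1 := notMem_supp.mp fun h => heg (hconf A hA.sparse hA.subset j h)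
        have h2 := notMem_supp.mp fun h => heg (hconf B hB.sparse hB.subset j h)
        have h3 := dist_triangle_right ((e * g) • c.f^[j] (c.Y A)) ((e * g) • c.f^[j] (c.Y B)) c.o
        linarith

variable [CompactSpace X] [ContinuousConstSMul G X]

/-- There is a pattern `A₀` such that near any occurrence of it (up to the distance `r`) the evolution
is independent of the rest of the configuration. -/
theorem exists_wall (H : Height N) (K : Subgroup G) [K.Normal] [K.FiniteIndex] {F : Set G}
    (hF : F.Finite) (r : ℤ) (hr : 0 ≤ r) :
    ∃ (A₀ : Set G) (q : ℤ), c.Admissible H K A₀ ∧ 0 ≤ q ∧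
      (∀ g ∈ F * (N : Set G), ∀ a, g * a⁻¹ ∈ c.Q → |H.ht a - H.ht g| ≤ q) ∧
      ∀ A B u, c.Admissible H K A → c.Admissible H K B → HasWall H A₀ q A u → HasWall H A₀ q B u →
        ∀ j, ∀ g ∈ F * (N : Set G), |H.ht g - u| ≤ r →
          dist (g • c.f^[j] (c.Y A)) (g • c.f^[j] (c.Y B)) ≤ 4 * c.η := by
  have hη := c.η_pos
  obtain ⟨V, hV, hdec⟩ := H.exists_decomp K hF
  obtain ⟨b, hb, hVb⟩ := hV.exists_abs_le H.ht
  -- Up to the periods in `per K`, these finitely many elements represent all of `F * N` at heights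
  -- at most `r` in absolute value.
  obtain ⟨ε, hε, hball⟩ := c.exists_ball_o
    (V := V * (fun m : ℤ => H.τ ^ m) '' Set.Icc (-(r + b)) (r + b))
    (hV.mul ((Set.finite_Icc _ _).image _))
  obtain ⟨_, ⟨A₀, hA₀, rfl⟩, ρ, hρ, J, hkill⟩ := c.nil.exists_uniformly_attracted c.continuous_f
    (C := c.Y '' {A | c.Admissible H K A}) ⟨_, ∅, admissible_empty, rfl⟩ hε
  obtain ⟨W, hW, hwin⟩ := c.exists_window hρ
  obtain ⟨q₀, hq₀, hWq⟩ := hW.exists_abs_le H.ht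
  obtain ⟨r₁, hr₁, hbd⟩ := H.exists_bound hF (c.finite_Q.inv.mul (c.pow_E_finite J))
  have hbd' : ∀ g ∈ F * (N : Set G), ∀ k ∈ c.E ^ J, ∀ a, k * g * a⁻¹ ∈ c.Q →
      |H.ht a - H.ht g| ≤ r₁ := by
    intro g hg k hk a ha
    have := hbd ((k * g * a⁻¹)⁻¹ * k) (Set.mul_mem_mul (Set.inv_mem_inv.mpr ha) hk) g hg
    have h2 : (k * g * a⁻¹)⁻¹ * k * g = a := by group
    rwa [h2] at this
  -- Shifting by `τ ^ u` puts the occurrence of `A₀` at height zero, where the Baire point `Y A₀`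
  -- attracts it. Periodicity then extends vanishing on the finite set to the whole height band.
  have killed : ∀ A u, c.Admissible H K A → HasWall H A₀ (q₀ + r + r₁) A u → ∀ j ≥ J,
      ∀ g ∈ F * (N : Set G), |H.ht g - u| ≤ r → g ∉ c.supp (c.f^[j] (c.Y A)) := by
    intro A u hA hwall j hj g hg hgu
    have hA' := hA.translate u
    have hclose := hwin _ _ hA'.sparse hA₀.sparse fun n hn => by
      by_cases hnN : n ∈ N
      · have := hwall (n * H.τ ^ u) (N.mul_mem hnN (H.zpow_mem u)) (by
          rw [H.ht_mul_zpow]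
          have := hWq n hn
          rw [abs_le] at this ⊢
          constructor <;> linarith)
        simpa using this
      · exact ⟨fun h => absurd (hA'.subset h) hnN, fun h => absurd (hA₀.subset h) hnN⟩
    have hsmall := hkill _ ⟨_, hA', rfl⟩ hclose j hj
    have hg' : g * H.τ ^ (-u) ∈ F * (N : Set G) := by
      obtain ⟨φ, hφ, n, hn, rfl⟩ := hg
      exact ⟨φ, hφ, _, N.mul_mem hn (H.zpow_mem _), (mul_assoc _ _ _).symm⟩
    obtain ⟨v, hv, l, hl, hgv⟩ := hdec _ hg'
    have hnot := hball _ hsmall (v * H.τ ^ (H.ht (g * H.τ ^ (-u)) - H.ht v)) (by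
      refine Set.mul_mem_mul hv ⟨_, ?_, rfl⟩
      rw [H.ht_mul_zpow]
      have := hVb v hv
      rw [abs_le] at this hgu
      constructor <;> linarith)
    intro hcon
    apply hnot
    have e1 : c.Y {n | n * H.τ ^ u ∈ A} = H.τ ^ u • c.Y A := (SumSystem.smul_Y hA.sparse _).symm
    rw [← hA'.smul_Y hl, iterate_smul, mem_supp_smul, ← hgv, e1, iterate_smul, mem_supp_smul]
    simpa using hcon
  refine ⟨A₀, q₀ + r + r₁, hA₀, by linarith, fun g hg a ha => ?_, ?_⟩
  · have := hbd' g hg 1 (c.pow_E_mono (Nat.zero_le J) (by simp)) a (by simpa using ha)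
    linarith
  intro A B u hA hB hwA hwB j g hg hgu
  -- From time `J` on, both configurations are negligible near the wall. Before time `J`, what
  -- happens there depends only on heights within `r + r₁` of the wall, where both sets copy `A₀`.
  rcases le_or_gt J j with hj | hj
  · have h1 := notMem_supp.mp (killed A u hA hwA j hj g hg hgu)
    have h2 := notMem_supp.mp (killed B u hB hwB j hj g hg hgu)
    have h3 := dist_triangle_right (g • c.f^[j] (c.Y A)) (g • c.f^[j] (c.Y B)) c.o
    linarith
  · refine dist_smul_iterate_le fun k hk => ?_
    refine (dist_smul_Y_le hA.sparse hB.sparse fun a ha => ?_).trans (by linarith)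
    by_cases haN : a ∈ N
    · have h1 := hbd' g hg k (c.pow_E_mono hj.le hk) a ha
      have h2 : |H.ht a - u| ≤ q₀ + r + r₁ := by
        rw [abs_le] at h1 hgu ⊢
        constructor <;> linarith
      rw [hwA a haN h2, hwB a haN h2]
    · exact ⟨fun h => absurd (hA.subset h) haN, fun h => absurd (hB.subset h) haN⟩

end SumSystem

/-! ### Arrangements of walls and their alterations. -/

namespace SumSystem

open LocalEndo

variable {G : Type u} {X : Type v} [Group G] [MetricSpace X] [MulAction G X] {c : SumSystem G X}
  {N : Subgroup G} {H : Height N} {K : Subgroup G}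

variable (H) in
/-- Copies of the part of `A₀` of heights at most `q`, moved to the heights `p * k` with `k ∈ P`. -/
def wallSet (A₀ : Set G) (q p : ℤ) (P : Set ℤ) : Set G :=
  {n | n ∈ N ∧ ∃ k ∈ P, |H.ht n - p * k| ≤ q ∧ n * H.τ ^ (-(p * k)) ∈ A₀}

theorem eq_of_abs_lt {p k k' d : ℤ} (h : |p * k - p * k'| ≤ d) (hd : d < p) : k = k' := by
  by_contra hne
  have h1 : 1 ≤ |k - k'| := Int.one_le_abs (sub_ne_zero.mpr hne)
  rw [← mul_sub, abs_mul] at h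
  have h2 : p ≤ |p| := le_abs_self p
  nlinarith [abs_nonneg p]

/-- `d` bounds the height difference of points of `N` whose `Q`-translates meet. The spacing `p > 2q
+ d` keeps distinct copies apart, and `hfar` keeps them apart from `A`. -/
theorem admissible_union_wallSet [K.Normal] {A₀ A : Set G} (hA₀ : c.Admissible H K A₀)
    (hA : c.Admissible H K A) {q p d : ℤ} (hp : 2 * q + d < p)
    (hd : ∀ a ∈ N, ∀ b ∈ N, ∀ g, g * a⁻¹ ∈ c.Q → g * b⁻¹ ∈ c.Q → |H.ht a - H.ht b| ≤ d)
    {P : Set ℤ} (hfar : ∀ a ∈ A, ∀ k ∈ P, q + d < |H.ht a - p * k|) :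
    c.Admissible H K (A ∪ wallSet H A₀ q p P) := by
  have hmixed : ∀ a ∈ A, ∀ b ∈ wallSet H A₀ q p P, ∀ g, g * a⁻¹ ∈ c.Q → g * b⁻¹ ∈ c.Q → False := by
    rintro a ha b ⟨hbN, k, hk, hbk, -⟩ g hga hgb
    have h1 := hd a (hA.subset ha) b hbN g hga hgb
    have h2 := hfar a ha k hk
    have h3 := abs_sub_le (H.ht a) (H.ht b) (p * k)
    linarith
  refine ⟨?_, ?_, ?_⟩
  · rintro a (ha | ha) b (hb | hb) g hga hgb
    · exact hA.sparse a ha b hb g hga hgb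
    · exact (hmixed a ha b hb g hga hgb).elim
    · exact (hmixed b hb a ha g hgb hga).elim
    · obtain ⟨haN, k, hk, hak, haA⟩ := ha
      obtain ⟨hbN, k', hk', hbk, hbA⟩ := hb
      have h1 := hd a haN b hbN g hga hgb
      have hkk : k = k' := by
        refine eq_of_abs_lt (p := p) (d := 2 * q + d) ?_ hp
        rw [abs_le] at h1 hak hbk ⊢
        constructor <;> linarith
      subst hkk
      have := hA₀.sparse _ haA _ hbA (g * H.τ ^ (-(p * k))) (by simpa using hga)
        (by simpa using hgb)
      exact mul_right_cancel this
  · rintro n (hn | hn)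
    exacts [hA.subset hn, hn.1]
  · rintro n (hn | ⟨hnN, k, hk, hnk, hnA⟩) l hl
    · exact Or.inl (hA.mul_mem n hn l hl)
    · refine Or.inr ⟨N.mul_mem hnN hl.1.1, k, hk, by rwa [H.ht_mul_per n hl], ?_⟩
      have := hA₀.mul_mem _ hnA _ (H.conj_mem_per hl (p * k))
      convert this using 1
      rw [zpow_neg]; group

theorem hasWall_union_wallSet {A₀ A : Set G} {q p : ℤ} (hp : 2 * q < p) {P : Set ℤ} {k : ℤ}
    (hk : k ∈ P) (hfar : ∀ a ∈ A, q < |H.ht a - p * k|) :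
    HasWall H A₀ q (A ∪ wallSet H A₀ q p P) (p * k) := by
  intro n hn hnk
  constructor
  · rintro (h | ⟨-, k', hk', hnk', hA⟩)
    · exact absurd hnk (not_le.mpr (hfar n h))
    · have : k = k' := by
        refine eq_of_abs_lt (p := p) (d := 2 * q) ?_ hp
        rw [abs_le] at hnk hnk' ⊢
        constructor <;> linarith
      rwa [this]
  · exact fun h => Or.inr ⟨hn, k, hk, hnk, h⟩

variable [CompactSpace X] [ContinuousConstSMul G X]

/-- Far away from the heights of interest, a configuration may be altered in such a way that from some
universal time on its evolution stays within bounded height. -/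
theorem exists_bounded_alteration (hN : c.Confines N) (H : Height N) (K : Subgroup G) [K.Normal]
    [K.FiniteIndex] :
    ∃ T : ℕ, ∀ A, c.Admissible H K A → ∀ R : ℤ, (∀ a ∈ A, |H.ht a| ≤ R) → ∀ m : ℤ,
      ∃ C, c.Admissible H K C ∧ (∀ n, |H.ht n| ≤ m → (n ∈ C ↔ n ∈ A)) ∧
        ∃ R' : ℤ, ∀ j ≥ T, ∀ g ∈ c.supp (c.f^[j] (c.Y C)), |H.ht g| ≤ R' := by
  have hη := c.η_pos
  obtain ⟨F, hF, hconf⟩ := hN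
  obtain ⟨r, hr0, hr⟩ := H.exists_bound hF c.finite_E
  obtain ⟨A₀, q, hA₀, hq0, hq, hwall⟩ := exists_wall (c := c) H K hF r hr0
  obtain ⟨d, hd0, hd'⟩ := H.exists_bound_mem (c.finite_Q.inv.mul c.finite_Q)
  have hd : ∀ a ∈ N, ∀ b ∈ N, ∀ g, g * a⁻¹ ∈ c.Q → g * b⁻¹ ∈ c.Q → |H.ht a - H.ht b| ≤ d := by
    intro a _ b hb g hga hgb
    have := hd' ((g * a⁻¹)⁻¹ * (g * b⁻¹)) (Set.mul_mem_mul (Set.inv_mem_inv.mpr hga) hgb) b hb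
    have h2 : (g * a⁻¹)⁻¹ * (g * b⁻¹) * b = a := by group
    rwa [h2] at this
  obtain ⟨p, hp⟩ : ∃ p : ℤ, 2 * q + d < p := ⟨_, lt_add_one _⟩
  have hp0 : 0 < p := by linarith
  -- Walls at all multiples of `p`: this configuration is periodic in height too, so it lives on
  -- finitely many cosets of its stabilizer and is mortal.
  set B := ∅ ∪ wallSet H A₀ q p Set.univ with hBdef
  have hB : c.Admissible H K B :=
    admissible_union_wallSet hA₀ admissible_empty hp hd fun _ h => h.elim
  have hBper : ∀ k₀ : ℤ, H.τ ^ (p * k₀) • c.Y B = c.Y B := by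
    have half : ∀ (k₀ : ℤ) (n : G), n ∈ B → n * H.τ ^ (p * k₀) ∈ B := by
      rintro k₀ n (h | ⟨hnN, k, -, hnk, hnA⟩)
      · exact h.elim
      · refine Or.inr ⟨N.mul_mem hnN (H.zpow_mem _), k + k₀, trivial, ?_, ?_⟩
        · rw [H.ht_mul_zpow]
          convert hnk using 2
          ring
        · convert hnA using 1
          rw [mul_assoc, ← zpow_add]
          congr 2
          ring
    intro k₀
    refine smul_Y_of_invariant hB.sparse fun n => ⟨fun h => ?_, half k₀ n⟩
    have := half (-k₀) _ h
    rwa [mul_assoc, ← zpow_add, ← mul_add, add_neg_cancel, mul_zero, zpow_zero, mul_one] at this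
  obtain ⟨V, hV, hdec⟩ := H.exists_decomp K hF
  obtain ⟨T₀, hT₀⟩ : ∃ n, c.f^[n] (c.Y B) = c.o := by
    refine exists_iterate_eq_o (V := V * (fun m : ℤ => H.τ ^ m) '' Set.Icc 0 p)
      (hV.mul ((Set.finite_Icc _ _).image _)) fun j g hg => ?_
    obtain ⟨v, hv, l, hl, hgv⟩ := hdec g (hconf B hB.sparse hB.subset j hg)
    set m := H.ht g - H.ht v
    refine ⟨v * H.τ ^ (m % p), Set.mul_mem_mul hv ⟨m % p,
      ⟨Int.emod_nonneg _ hp0.ne', (Int.emod_lt_of_pos _ hp0).le⟩, rfl⟩,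
      H.τ ^ (p * (m / p)) * l, by rw [mul_smul, hB.smul_Y hl, hBper], ?_⟩
    rw [hgv, mul_assoc v, mul_assoc v, ← mul_assoc (H.τ ^ (m % p)), ← zpow_add,
      Int.emod_add_mul_ediv]
  refine ⟨T₀ + 1, fun A hA R hR m => ?_⟩
  -- The first bound keeps the walls from touching `A`; the second keeps them out of heights at most
  -- `m`.
  obtain ⟨κ, hκ0, hκ⟩ : ∃ κ : ℤ, 0 ≤ κ ∧ R + q + d < p * κ ∧ m + q < p * κ := by
    refine ⟨|R| + |m| + q + d + 1, by positivity, ?_⟩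
    have h1 := le_abs_self R
    have h2 := le_abs_self m
    have h3 := abs_nonneg R
    have h4 := abs_nonneg m
    constructor <;> nlinarith
  set P : Set ℤ := {k | κ ≤ |k|} with hP
  have hPlarge : ∀ k ∈ P, p * κ ≤ |p * k| := by
    intro k hk
    rw [abs_mul, abs_of_pos hp0]
    exact mul_le_mul_of_nonneg_left hk hp0.le
  have hfar : ∀ a ∈ A, ∀ k ∈ P, q + d < |H.ht a - p * k| := by
    intro a ha k hk
    have h1 := hR a ha
    have h2 := hPlarge k hk
    have h3 := abs_sub_abs_le_abs_sub (p * k) (H.ht a)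
    rw [abs_sub_comm] at h3
    linarith
  set C := A ∪ wallSet H A₀ q p P with hCdef
  have hC : c.Admissible H K C := admissible_union_wallSet hA₀ hA hp hd hfar
  have hCht : ∀ n ∈ wallSet H A₀ q p P, p * κ - q ≤ |H.ht n| := by
    rintro n ⟨-, k, hk, hnk, -⟩
    have h2 := hPlarge k hk
    have h3 := abs_sub_abs_le_abs_sub (p * k) (H.ht n)
    rw [abs_sub_comm] at h3
    linarith
  refine ⟨C, hC, fun n hn => ⟨?_, Or.inl⟩, p * κ + r, ?_⟩
  · rintro (h | h)
    · exact h
    · have := hCht n h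
      linarith
  -- Beyond the two innermost walls, at heights `± p * κ`, the altered configuration contains the
  -- same points as `B` and hence evolves like it.
  have hagree := dist_le_of_hasWall (c := c) (H := H) (K := K) hconf hr hq hwall hC hB
    (I := {v | p * κ ≤ |v|}) (U := {p * κ, p * (-κ)}) (by
      intro v hv
      change p * κ ≤ |v| at hv
      by_cases hvr : |v| ≤ p * κ + r
      · left
        rcases le_total 0 v with h | h
        · refine ⟨_, Or.inl rfl, ?_⟩
          rw [abs_of_nonneg h] at hv hvr
          rw [abs_le]; constructor <;> linarith
        · refine ⟨_, Or.inr rfl, ?_⟩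
          rw [abs_of_nonpos h] at hv hvr
          rw [abs_le]; constructor <;> linarith
      · right
        intro v' hv'
        have h3 := abs_sub_abs_le_abs_sub v v'
        rw [abs_sub_comm] at h3
        change p * κ ≤ |v'|
        linarith)
    (by
      have hw : ∀ k ∈ P, HasWall H A₀ q C (p * k) := fun k hk =>
        hasWall_union_wallSet (by linarith) hk fun a ha => by linarith [hfar a ha k hk]
      rintro u (rfl | rfl)
      · exact hw κ (le_abs_self κ)
      · exact hw (-κ) (by change κ ≤ |-κ|; rw [abs_neg]; exact le_abs_self κ))
    (by
      have hw : ∀ k, HasWall H A₀ q B (p * k) := fun k =>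
        hasWall_union_wallSet (by linarith) (Set.mem_univ k) fun a ha => ha.elim
      rintro u (rfl | rfl)
      exacts [hw _, hw _])
    (by
      intro n hn v hv hnv
      change p * κ ≤ |v| at hv
      have hnht : p * κ - q ≤ |H.ht n| := by
        have h3 := abs_sub_abs_le_abs_sub v (H.ht n)
        rw [abs_sub_comm] at h3
        linarith
      constructor
      · rintro (h | ⟨h1, k, -, h2⟩)
        · have := hR n h
          linarith
        · exact Or.inr ⟨h1, k, trivial, h2⟩
      · rintro (h | ⟨h1, k, -, h2, h3⟩)
        · exact h.elim
        · refine Or.inr ⟨h1, k, ?_, h2, h3⟩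
          have h4 := abs_sub_abs_le_abs_sub (H.ht n) (p * k)
          have h5 : p * (κ - 1) < p * |k| := by
            rw [abs_mul, abs_of_pos hp0] at h4
            linarith
          have := lt_of_mul_lt_mul_left h5 hp0.le
          change κ ≤ |k|
          linarith)
  intro j hj g hg
  by_contra hcon
  push Not at hcon
  obtain ⟨i, rfl⟩ : ∃ i, j = i + 1 := ⟨j - 1, by omega⟩
  have hgF := hconf C hC.sparse hC.subset _ hg
  rw [Function.iterate_succ_apply'] at hg
  -- Once `Y B` has died, agreement only gives `4η`-closeness to `o`. One more step of `f` sharpens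
  -- it to `η`; hence `T₀ + 1`, and the extra `r` in the height bound.
  refine notMem_supp.mpr (dist_smul_map_o_le fun e he => ?_) hg
  by_cases heg : e * g ∈ F * (N : Set G)
  · have h1 := hr e he g hgF
    have h2 := abs_sub_abs_le_abs_sub (H.ht g) (H.ht (e * g))
    rw [abs_sub_comm] at h2
    have h3 := hagree i (e * g) heg (by change p * κ ≤ _; linarith)
    rwa [iterate_eq_o_of_le hT₀ (by omega : T₀ ≤ i), c.smul_o] at h3
  · have := notMem_supp.mp fun h => heg (hconf C hC.sparse hC.subset i h)
    linarith

end SumSystem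

theorem Group.ResiduallyFinite.exists_normal_finiteIndex {G : Type u} [Group G]
    (hG : Group.ResiduallyFinite G) (K₀ : Subgroup G) (hn : K₀.Normal) (hi : K₀.FiniteIndex)
    {Z : Set G} (hZ : Z.Finite) :
    ∃ K ≤ K₀, K.Normal ∧ K.FiniteIndex ∧ ∀ z ∈ Z, z ∈ K → z = 1 := by
  induction Z, hZ using Set.Finite.induction_on with
  | empty => exact ⟨K₀, le_rfl, hn, hi, fun _ h => h.elim⟩
  | @insert a Z _ _ ih =>
    obtain ⟨K, hK, hKn, hKi, h⟩ := ih
    by_cases ha : a = 1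
    · refine ⟨K, hK, hKn, hKi, ?_⟩
      rintro z (rfl | hz) hzK
      exacts [ha, h z hz hzK]
    · obtain ⟨L, hL⟩ := Group.exists_finiteIndexNormalSubgroup_notMem a ha
      have : (L.toSubgroup).Normal := L.isNormal'
      have : (L.toSubgroup).FiniteIndex := L.isFiniteIndex'
      refine ⟨K ⊓ L.toSubgroup, inf_le_left.trans hK, inferInstance, inferInstance, ?_⟩
      rintro z (rfl | hz) hzK
      exacts [absurd hzK.2 hL, h z hz hzK.1]

/-! ### Mortality of periodic configurations and descent to the kernel of a height. -/

namespace SumSystem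

open LocalEndo

variable {G : Type u} {X : Type v} [Group G] [MetricSpace X] [MulAction G X] {c : SumSystem G X}
  {N : Subgroup G} {H : Height N} {K : Subgroup G}

/-- Modulo the periods, which fix `x`, only finitely many elements of `F * N` have bounded height.
-/
theorem exists_iterate_eq_o_of_ht_le [ContinuousConstSMul G X] [K.Normal] [K.FiniteIndex]
    {F : Set G} (hF : F.Finite) {x : X} (hfix : ∀ l ∈ H.per K, l • x = x) {R : ℤ}
    (h : ∀ j, ∀ g ∈ c.supp (c.f^[j] x), g ∈ F * (N : Set G) ∧ |H.ht g| ≤ R) :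
    ∃ n, c.f^[n] x = c.o := by
  obtain ⟨V, hV, hdec⟩ := H.exists_decomp K hF
  obtain ⟨b, -, hVb⟩ := hV.exists_abs_le H.ht
  refine exists_iterate_eq_o (V := V * (fun m : ℤ => H.τ ^ m) '' Set.Icc (-(R + b)) (R + b))
    (hV.mul ((Set.finite_Icc _ _).image _)) fun j g hg => ?_
  obtain ⟨hgF, hgR⟩ := h j g hg
  obtain ⟨v, hv, l, hl, hgv⟩ := hdec g hgF
  refine ⟨_, Set.mul_mem_mul hv ⟨H.ht g - H.ht v, ?_, rfl⟩, l, hfix l hl, hgv⟩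
  have := hVb v hv
  rw [abs_le] at this hgR
  constructor <;> linarith

variable [CompactSpace X] [ContinuousConstSMul G X]

/-- A periodic configuration of bounded height is mortal. -/
theorem Admissible.exists_iterate_eq_o (hN : c.Confines N) [K.Normal] [K.FiniteIndex] {A : Set G}
    (hA : c.Admissible H K A) {R : ℤ} (hR : ∀ a ∈ A, |H.ht a| ≤ R) :
    ∃ n, c.f^[n] (c.Y A) = c.o := by
  have hη := c.η_pos
  by_contra hcon
  obtain ⟨T, halt⟩ := exists_bounded_alteration hN H K
  obtain ⟨F, hF, hconf⟩ := hN
  have hunb : ∀ R' : ℤ, ∃ j, ∃ g ∈ c.supp (c.f^[j] (c.Y A)), R' < |H.ht g| := by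
    intro R'
    by_contra hb
    push Not at hb
    exact hcon (exists_iterate_eq_o_of_ht_le hF (fun l hl => hA.smul_Y hl)
      fun j g hg => ⟨hconf A hA.sparse hA.subset j hg, hb j g hg⟩)
  obtain ⟨V, hV, hdec⟩ := H.exists_decomp K hF
  obtain ⟨b, hb0, hVb⟩ := hV.exists_abs_le H.ht
  obtain ⟨ε, hε, hball⟩ := c.exists_ball_o hV
  -- Mortality is part of the family: the Baire point must die before a distant summand can be
  -- followed. A disturbed point must therefore be mortal again, so the immortal `Y A` cannot be
  -- added itself; its alteration `C` is used instead.
  let 𝒞 : Set X := {x | ∃ (I : Type u) (h : I → X), (∀ i, h i ∈ c.S) ∧ c.Separated c.D h ∧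
    c.IsSum c.D h x ∧ (∃ Φ : Set G, Φ.Finite ∧ ∃ R : ℤ, ∀ i, ∀ g ∈ c.supp (h i),
      g ∈ Φ * (N : Set G) ∧ |H.ht g| ≤ R) ∧ ∃ n, c.f^[n] x = c.o}
  have ho : c.o ∈ 𝒞 := by
    refine ⟨PEmpty, PEmpty.elim, fun i => i.elim, fun i => i.elim, ⟨fun i => i.elim, fun g _ => ?_⟩,
      ⟨∅, Set.finite_empty, 0, fun i => i.elim⟩, 0, rfl⟩
    rw [c.smul_o, dist_self]
    exact hη.le
  obtain ⟨x₀, ⟨I, h, hS, hsep, hsum, ⟨Φ, hΦ, R₁, hR₁⟩, T₁, hT₁⟩, ρ, hρ, J, hkill⟩ :=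
    c.nil.exists_uniformly_attracted c.continuous_f ⟨_, ho⟩ hε
  obtain ⟨W₁, hW₁, hwin⟩ := exists_finite_expansivity_window c.eq_of_close hρ
  set Ω : Set G := (c.E ^ T)⁻¹ * c.Q with hΩdef
  have hΩ : Ω.Finite := (c.pow_E_finite T).inv.mul c.finite_Q
  obtain ⟨r₁, hr₁0, hr₁⟩ := H.exists_bound hΦ ((hΩ.inv.mul c.finite_D.inv).mul c.finite_D)
  obtain ⟨r₂, hr₂0, hr₂⟩ := H.exists_bound hΦ
    (((hΩ.inv.mul (c.pow_E_finite T₁)).mul (c.pow_E_finite T₁).inv).mul c.finite_D)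
  obtain ⟨r₃, hr₃0, hr₃⟩ := (hΩ.inv.mul hW₁).exists_abs_le H.ht
  obtain ⟨r₄, hr₄0, hr₄⟩ := H.exists_bound_mem
    ((c.pow_E_finite (T + J + T₁)).inv.mul c.finite_Q)
  -- Beyond this height a disturbance is separated from the summands of `x₀` (`r₁`), does not
  -- interact with them for `T₁` steps (`r₂`), and is invisible in the window defining closeness to
  -- `x₀` (`r₃`).
  set R₂ := |R₁| + r₁ + r₂ + r₃ with hR₂
  have hR₁a := le_abs_self R₁
  have hR₁n := abs_nonneg R₁
  have hRa := le_abs_self R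
  have hRn := abs_nonneg R
  obtain ⟨j, g, hg, hgR⟩ := hunb (R₂ + |R| + r₄ + b)
  -- By finite speed, so great a height can only be reached late.
  have hj : T + J + T₁ < j := by
    by_contra hle
    push Not at hle
    obtain ⟨k, hk, q, hq, a, ha, hgk⟩ := exists_of_mem_supp_iterate_Y hA.sparse hg
    have h1 := hr₄ (k⁻¹ * q) (Set.mul_mem_mul (Set.inv_mem_inv.mpr (c.pow_E_mono hle hk)) hq) a
      (hA.subset ha)
    rw [mul_assoc, ← hgk] at h1
    have h2 := abs_sub_abs_le_abs_sub (H.ht g) (H.ht a)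
    have h3 := hR a ha
    linarith
  obtain ⟨v, hv, l, hl, hgv⟩ := hdec g (hconf A hA.sparse hA.subset j hg)
  set m := H.ht g - H.ht v with hm
  have hmR : R₂ + |R| + r₄ < |m| := by
    have h1 := abs_sub_abs_le_abs_sub (H.ht g) (H.ht v)
    have h2 := hVb v hv
    linarith
  have hvm : v * H.τ ^ m ∈ c.supp (c.f^[j] (c.Y A)) := by
    rw [← hA.smul_Y hl, iterate_smul, mem_supp_smul, ← hgv]
    exact hg
  obtain ⟨W, hW, hWsupp⟩ := exists_window_supp hA.sparse hvm
  obtain ⟨b', hb'0, hWb'⟩ := hW.exists_abs_le H.ht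
  obtain ⟨C, hC, hCA, R₃, hR₃⟩ := halt A hA R hR (R₂ + |m| + b')
  have hR₂0 : 0 ≤ R₂ := by linarith
  have hmn := abs_nonneg m
  have hvC : v * H.τ ^ m ∈ c.supp (c.f^[j] (c.Y C)) :=
    hWsupp C hC.sparse fun n hn => hCA n (by linarith [hWb' n hn])
  -- The shift moves the event from `v * τ ^ m` to `v`. Starting from time `T` ensures bounded
  -- height at all later times, hence mortality. This is an iterate rather than a value of `Y`,
  -- which is why the family is built from points of `S`.
  set w := H.τ ^ m • c.f^[T] (c.Y C) with hw
  have hwsupp : ∀ g ∈ c.supp w, ∃ ω ∈ Ω, ∃ n, R₂ < |H.ht n| ∧ n = ω⁻¹ * g := by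
    intro g hg
    rw [hw, mem_supp_smul] at hg
    obtain ⟨k, hk, q, hq, a, ha, hga⟩ := exists_of_mem_supp_iterate_Y hC.sparse hg
    refine ⟨k⁻¹ * q, Set.mul_mem_mul (Set.inv_mem_inv.mpr hk) hq, a * H.τ ^ (-m), ?_, ?_⟩
    -- Points of `C` at moderate height belong to `A` and are carried far by the shift; the
    -- remaining ones are too high to be brought back.
    · rw [H.ht_mul_zpow]
      by_cases ham : |H.ht a| ≤ R₂ + |m| + b'
      · have h1 := hR a ((hCA a ham).mp ha)
        have h2 := abs_sub_abs_le_abs_sub m (H.ht a)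
        rw [abs_sub_comm m (H.ht a)] at h2
        rw [← sub_eq_add_neg]
        linarith
      · push Not at ham
        have h2 := abs_sub_abs_le_abs_sub (H.ht a) m
        rw [← sub_eq_add_neg]
        linarith
    · have h1 : g = k⁻¹ * (q * a) * H.τ ^ (-m) := by rw [← hga]; group
      rw [h1]; group
  have hxsupp : ∀ g ∈ c.supp x₀, ∃ i, g ∈ c.D * c.supp (h i) := by
    intro g hg
    by_contra hno
    push Not at hno
    exact notMem_supp.mpr (hsum.2 g hno) hg
  have hfar : ∀ i, ∀ g ∈ c.D * c.supp w, g ∉ c.D * c.supp (h i) := by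
    rintro i _ ⟨d, hd, s, hs, rfl⟩ ⟨d', hd', s', hs', heq⟩
    obtain ⟨ω, hω, n, hn, rfl⟩ := hwsupp s hs
    obtain ⟨h1, h2⟩ := hR₁ i s' hs'
    have h3 := hr₁ (ω⁻¹ * d⁻¹ * d') (Set.mul_mem_mul (Set.mul_mem_mul (Set.inv_mem_inv.mpr hω)
      (Set.inv_mem_inv.mpr hd)) hd') s' h1
    have h4 : ω⁻¹ * d⁻¹ * d' * s' = ω⁻¹ * s := by
      dsimp only at heq
      rw [mul_assoc _ d', heq]; group
    rw [h4] at h3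
    have h5 := abs_sub_abs_le_abs_sub (H.ht (ω⁻¹ * s)) (H.ht s')
    linarith
  have hsep' : c.Separated c.D (fun i : Option I => i.elim w h) := by
    rintro (_ | i) (_ | i') g hg hg'
    · rfl
    · exact absurd hg' (hfar i' g hg)
    · exact absurd hg (hfar i g hg')
    · rw [hsep i i' g hg hg']
  have hYS : c.f^[T] (c.Y C) ∈ c.S := iterate_mem (c.Y_mem C hC.sparse) T
  have hS' : ∀ i : Option I, i.elim w h ∈ c.S := by
    rintro (_ | i)
    exacts [c.smul_mem _ hYS _, hS i]
  obtain ⟨x', hx'⟩ := c.exists_isSum (Option I) _ hS' hsep'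
  have hsup := hsum.superposes_option c.one_mem_D hx'
  have hiter : ∀ i, T₁ ≤ i → c.f^[i] x' = c.f^[i] w := by
    intro i hi
    refine hsup.iterate_eq ?_ hT₁ hi
    intro a ha s hs k hk k' hk' heq
    obtain ⟨i, d, hd, s', hs', rfl⟩ := hxsupp a ha
    obtain ⟨ω, hω, n, hn, rfl⟩ := hwsupp s hs
    obtain ⟨h1, h2⟩ := hR₁ i s' hs'
    have h3 := hr₂ (ω⁻¹ * k' * k⁻¹ * d) (Set.mul_mem_mul (Set.mul_mem_mul (Set.mul_mem_mul
      (Set.inv_mem_inv.mpr hω) hk') (Set.inv_mem_inv.mpr hk)) hd) s' h1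
    have h4 : ω⁻¹ * k' * k⁻¹ * d * s' = ω⁻¹ * s := by
      have h6 : s = k' * (k⁻¹ * (d * s')) := by rw [heq]; group
      rw [h6]; group
    rw [h4] at h3
    have h5 := abs_sub_abs_le_abs_sub (H.ht (ω⁻¹ * s)) (H.ht s')
    linarith
  have hclose : dist x' x₀ < ρ := by
    refine hwin _ _ fun g hg => hsup.1 g fun hgw => ?_
    obtain ⟨ω, hω, n, hn, rfl⟩ := hwsupp g hgw
    have := hr₃ (ω⁻¹ * g) (Set.mul_mem_mul (Set.inv_mem_inv.mpr hω) hg)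
    linarith
  have hfT : ∀ i, c.f^[i] w = H.τ ^ m • c.f^[i + T] (c.Y C) := by
    intro i
    rw [hw, iterate_smul, ← Function.iterate_add_apply]
  obtain ⟨n, hn⟩ : ∃ n, c.f^[n] (c.f^[T] (c.Y C)) = c.o := by
    refine exists_iterate_eq_o_of_ht_le (H := H) (K := K) (R := R₃) hF (fun l hl => ?_)
      fun i g hg => ?_
    · rw [← iterate_smul, hC.smul_Y hl]
    · rw [← Function.iterate_add_apply] at hg
      exact ⟨hconf C hC.sparse hC.subset _ hg, hR₃ _ (by omega) g hg⟩
  have hx'𝒞 : x' ∈ 𝒞 := by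
    refine ⟨Option I, _, hS', hsep', hx', ⟨Φ ∪ F, hΦ.union hF, |R₁| + |R₃| + |m|, ?_⟩, n + T₁, ?_⟩
    · have hR₃n := abs_nonneg R₃
      have hR₃a := le_abs_self R₃
      rintro (_ | i) g hg
      · change g ∈ c.supp w at hg
        rw [hw, mem_supp_smul] at hg
        have h1 := hR₃ T le_rfl _ hg
        rw [H.ht_mul_zpow] at h1
        obtain ⟨φ, hφ, n', hn', hgn⟩ := hconf C hC.sparse hC.subset _ hg
        refine ⟨⟨φ, Or.inr hφ, n' * H.τ ^ (-m), N.mul_mem hn' (H.zpow_mem _), ?_⟩, ?_⟩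
        · dsimp only at hgn ⊢
          rw [← mul_assoc, hgn]; group
        · have h2 := abs_sub (H.ht g + m) m
          rw [add_sub_cancel_right] at h2
          linarith
      · obtain ⟨⟨φ, hφ, n', hn', hgn⟩, h2⟩ := hR₁ i g hg
        exact ⟨⟨φ, Or.inl hφ, n', hn', hgn⟩, by linarith⟩
    · rw [hiter _ (by omega), hw, iterate_smul, iterate_eq_o_of_le hn (by omega), c.smul_o]
  -- The contradiction: `x'` lies in the family near `x₀`, so it vanishes at `v` after time `J`, yet
  -- after `T₁` it evolves like `w`, which is visible at `v` at time `j - T`.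
  have hdead := hball _ (hkill x' hx'𝒞 hclose (j - T) (by omega)) v hv
  rw [hiter _ (by omega), hfT, mem_supp_smul, Nat.sub_add_cancel (by omega)] at hdead
  exact hdead hvC

/-- Confinement passes from `N` to the kernel of a homomorphism from `N` onto `ℤ`. -/
theorem Confines.ker (hG : Group.ResiduallyFinite G) (hN : c.Confines N) (H : Height N) :
    c.Confines H.ker := by
  by_contra hcon
  have hN' := hN
  obtain ⟨F, hF, hconf⟩ := hN'
  obtain ⟨V, hV, hdec⟩ := H.exists_decomp ⊤ hF
  obtain ⟨b, hb0, hVb⟩ := hV.exists_abs_le H.ht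
  -- The period `l` lies in the kernel, so it can be absorbed by translating `A` within the kernel;
  -- this leaves an event of the form `v * τ ^ m`.
  have hunb : ∀ R : ℤ, ∃ A, c.Sparse A ∧ A ⊆ H.ker ∧ ∃ j, ∃ v ∈ V, ∃ m : ℤ, R < |m| ∧
      v * H.τ ^ m ∈ c.supp (c.f^[j] (c.Y A)) := by
    intro R
    by_contra hbd
    push Not at hbd
    refine hcon ⟨V * (fun m : ℤ => H.τ ^ m) '' Set.Icc (-R) R,
      hV.mul ((Set.finite_Icc _ _).image _), fun A hA hAk j g hg => ?_⟩
    obtain ⟨v, hv, l, hl, hgv⟩ := hdec g (hconf A hA (hAk.trans H.ker_le) j hg)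
    have hR := hbd {n | n * l ∈ A} (hA.translate l) (fun n hn => by
      have := H.ker.mul_mem (hAk hn) (H.ker.inv_mem hl.1)
      simpa using this) j v hv (H.ht g - H.ht v)
    refine ⟨_, Set.mul_mem_mul hv ⟨H.ht g - H.ht v, abs_le.mp (not_lt.mp fun hlt => ?_), rfl⟩, l,
      hl.1, hgv.symm⟩
    refine hR hlt ?_
    rw [← smul_Y hA, iterate_smul, mem_supp_smul, ← hgv]
    exact hg
  obtain ⟨ε, hε, hball⟩ := c.exists_ball_o hV
  -- `K` varies within the family because the period of the disturbance is only known after the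
  -- Baire point has been found.
  let 𝒞 : Set X := {x | ∃ (A : Set G) (K : Subgroup G), K.Normal ∧ K.FiniteIndex ∧
    c.Admissible H K A ∧ (∃ R : ℤ, ∀ a ∈ A, |H.ht a| ≤ R) ∧ c.Y A = x}
  obtain ⟨_, ⟨A₀, K₀, hK₀n, hK₀i, hA₀, ⟨R₀, hR₀⟩, rfl⟩, ρ, hρ, J, hkill⟩ :=
    c.nil.exists_uniformly_attracted c.continuous_f (C := 𝒞) ⟨_, ∅, ⊤, inferInstance, inferInstance,
      admissible_empty, ⟨0, fun _ h => h.elim⟩, rfl⟩ hε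
  obtain ⟨T₀, hT₀⟩ := hA₀.exists_iterate_eq_o hN hR₀
  obtain ⟨W₁, hW₁, hwin⟩ := c.exists_window hρ
  obtain ⟨r₁, hr₁0, hr₁⟩ := hW₁.exists_abs_le H.ht
  obtain ⟨d, hd0, hd⟩ := H.exists_bound_mem (c.finite_Q.inv.mul c.finite_Q)
  obtain ⟨r₂, hr₂0, hr₂⟩ := H.exists_bound_mem
    (((c.finite_Q.inv.mul (c.pow_E_finite T₀)).mul (c.pow_E_finite T₀).inv).mul c.finite_Q)
  obtain ⟨r₄, hr₄0, hr₄⟩ := H.exists_bound_mem ((c.pow_E_finite (J + T₀)).inv.mul c.finite_Q)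
  obtain ⟨A, hA, hAk, j, v, hv, m, hm, hvm⟩ := hunb (|R₀| + d + r₂ + r₄ + b + r₁)
  have hR₀a := le_abs_self R₀
  have hR₀n := abs_nonneg R₀
  have hj : J + T₀ < j := by
    by_contra hle
    push Not at hle
    obtain ⟨k, hk, q, hq, a, ha, hgk⟩ := exists_of_mem_supp_iterate_Y hA hvm
    have h1 := hr₄ (k⁻¹ * q) (Set.mul_mem_mul (Set.inv_mem_inv.mpr (c.pow_E_mono hle hk)) hq) a
      (hAk ha).1
    rw [mul_assoc, ← hgk, (hAk ha).2, H.ht_mul_zpow, sub_zero] at h1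
    have h2 := hVb v hv
    have h3 := abs_sub (H.ht v + m) (H.ht v)
    rw [add_sub_cancel_left] at h3
    linarith
  -- Seen from `v`, the configuration now sits at the single distant height `-m`.
  set A₁ : Set G := {n | n * H.τ ^ m ∈ A} with hA₁def
  have hA₁ : c.Sparse A₁ := hA.translate _
  have hA₁ht : ∀ n ∈ A₁, n ∈ N ∧ H.ht n = -m := by
    intro n hn
    have h1 := hAk hn
    refine ⟨by simpa using N.mul_mem h1.1 (N.inv_mem (H.zpow_mem m)), ?_⟩
    have h2 := h1.2
    rw [H.ht_mul_zpow] at h2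
    linarith
  have hv₁ : v ∈ c.supp (c.f^[j] (c.Y A₁)) := by
    rw [hA₁def, ← smul_Y hA, iterate_smul, mem_supp_smul]
    exact hvm
  obtain ⟨W, hW, hWsupp⟩ := exists_window_supp hA₁ hv₁
  set A₂ : Set G := A₁ ∩ W with hA₂def
  have hA₂ : c.Sparse A₂ := hA₁.mono Set.inter_subset_left
  have hA₂fin : A₂.Finite := hW.inter_of_right _
  have hv₂ : v ∈ c.supp (c.f^[j] (c.Y A₂)) :=
    hWsupp A₂ hA₂ fun n hn => ⟨fun h => h.1, fun h => ⟨h, hn⟩⟩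
  obtain ⟨W₂, hW₂, hW₂supp⟩ := exists_window_supp hA₂ hv₂
  -- Residual finiteness is used here. Avoiding the first finite set keeps the periodized `A₂`
  -- sparse; avoiding the second keeps it unchanged on `W₂`, so the event at `v` survives. Since `K₁
  -- ≤ K₀`, the set `A₀` stays periodic.
  obtain ⟨K₁, hK₁le, hK₁n, hK₁i, hK₁⟩ := hG.exists_normal_finiteIndex K₀ hK₀n hK₀i
    (((((hA₂fin.inv.mul c.finite_Q.inv).mul c.finite_Q).mul hA₂fin)).union (hA₂fin.inv.mul hW₂))
  set A₃ : Set G := {n | ∃ a ∈ A₂, ∃ l ∈ H.per K₁, n = a * l} with hA₃def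
  have hA₃ht : ∀ n ∈ A₃, n ∈ N ∧ H.ht n = -m := by
    rintro _ ⟨a, ha, l, hl, rfl⟩
    exact ⟨N.mul_mem (hA₁ht a ha.1).1 hl.1.1, by rw [H.ht_mul_per _ hl]; exact (hA₁ht a ha.1).2⟩
  have hA₃ : c.Sparse A₃ := by
    rintro _ ⟨a, ha, l, hl, rfl⟩ _ ⟨a', ha', l', hl', rfl⟩ g hg hg'
    have hll : l * l'⁻¹ = 1 := by
      refine hK₁ _ (Or.inl ?_) (K₁.mul_mem hl.2 (K₁.inv_mem hl'.2))
      refine ⟨a⁻¹ * (g * (a * l)⁻¹)⁻¹ * (g * (a' * l')⁻¹), Set.mul_mem_mul (Set.mul_mem_mul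
        (Set.inv_mem_inv.mpr ha) (Set.inv_mem_inv.mpr hg)) hg', a', ha', ?_⟩
      dsimp only
      group
    have hll' : l = l' := by rwa [mul_inv_eq_one] at hll
    subst hll'
    rw [hA₂ a ha a' ha' (g * l⁻¹) (by simpa [mul_assoc] using hg) (by simpa [mul_assoc] using hg')]
  have hv₃ : v ∈ c.supp (c.f^[j] (c.Y A₃)) := by
    refine hW₂supp A₃ hA₃ fun n hn => ⟨?_, fun h => ⟨n, h, 1, (H.per K₁).one_mem, by simp⟩⟩
    rintro ⟨a, ha, l, hl, rfl⟩
    have : l = 1 := hK₁ l (Or.inr ⟨a⁻¹, Set.inv_mem_inv.mpr ha, _, hn, by simp⟩) hl.2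
    simpa [this] using ha
  have hmixed : ∀ a ∈ A₀, ∀ a' ∈ A₃, ∀ g, g * a⁻¹ ∈ c.Q → g * a'⁻¹ ∈ c.Q → False := by
    intro a ha a' ha' g hg hg'
    have h1 := hd ((g * a'⁻¹)⁻¹ * (g * a⁻¹)) (Set.mul_mem_mul (Set.inv_mem_inv.mpr hg') hg) a
      (hA₀.subset ha)
    have h2 : (g * a'⁻¹)⁻¹ * (g * a⁻¹) * a = a' := by group
    rw [h2, (hA₃ht a' ha').2] at h1
    have h3 := abs_sub_abs_le_abs_sub (-m) (H.ht a)
    have h4 := hR₀ a ha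
    rw [abs_neg] at h3
    linarith
  have hunion : c.Admissible H K₁ (A₀ ∪ A₃) := by
    refine ⟨?_, ?_, ?_⟩
    · rintro a (ha | ha) a' (ha' | ha') g hg hg'
      · exact hA₀.sparse a ha a' ha' g hg hg'
      · exact (hmixed a ha a' ha' g hg hg').elim
      · exact (hmixed a' ha' a ha g hg' hg).elim
      · exact hA₃ a ha a' ha' g hg hg'
    · rintro a (ha | ha)
      exacts [hA₀.subset ha, (hA₃ht a ha).1]
    · rintro a (ha | ⟨a', ha', l', hl', rfl⟩) l hl
      · exact Or.inl (hA₀.mul_mem a ha l ⟨hl.1, hK₁le hl.2⟩)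
      · exact Or.inr ⟨a', ha', l' * l, (H.per K₁).mul_mem hl' hl, mul_assoc _ _ _⟩
  have hclose : dist (c.Y (A₀ ∪ A₃)) (c.Y A₀) < ρ := by
    refine hwin _ _ hunion.sparse hA₀.sparse fun n hn => ⟨?_, Or.inl⟩
    rintro (h | h)
    · exact h
    · have h1 := hr₁ n hn
      rw [(hA₃ht n h).2, abs_neg] at h1
      linarith
  have hiter : c.f^[j] (c.Y (A₀ ∪ A₃)) = c.f^[j] (c.Y A₃) := by
    refine (superposes_union hunion.sparse).iterate_eq ?_ hT₀ (by omega)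
    intro s hs s' hs' k hk k' hk' heq
    obtain ⟨a, ha, hq⟩ := exists_of_mem_supp_Y hA₀.sparse hs
    obtain ⟨a', ha', hq'⟩ := exists_of_mem_supp_Y hA₃ hs'
    have h1 := hr₂ ((s' * a'⁻¹)⁻¹ * k' * k⁻¹ * (s * a⁻¹)) (Set.mul_mem_mul (Set.mul_mem_mul
      (Set.mul_mem_mul (Set.inv_mem_inv.mpr hq') hk') (Set.inv_mem_inv.mpr hk)) hq) a
      (hA₀.subset ha)
    have h2 : (s' * a'⁻¹)⁻¹ * k' * k⁻¹ * (s * a⁻¹) * a = a' := by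
      have h6 : s = k * (k'⁻¹ * s') := by rw [← heq]; group
      rw [h6]; group
    rw [h2, (hA₃ht a' ha').2] at h1
    have h3 := abs_sub_abs_le_abs_sub (-m) (H.ht a)
    have h4 := hR₀ a ha
    rw [abs_neg] at h3
    linarith
  -- The union is a neighbour of `Y A₀` in the family, hence dead at `v` at time `j`; but `Y A₀` is
  -- gone by then, so the union shows the event of `A₃`.
  have hdead := hball _ (hkill _ ⟨A₀ ∪ A₃, K₁, hK₁n, hK₁i, hunion, ⟨|R₀| + |m|, ?_⟩, rfl⟩ hclose j
    (by omega)) v hv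
  · rw [hiter] at hdead
    exact hdead hv₃
  · have := abs_nonneg m
    rintro a (ha | ha)
    · linarith [hR₀ a ha]
    · rw [(hA₃ht a ha).2, abs_neg]
      linarith

end SumSystem

/-! ### Descending a series -/

/-- Coset representatives extend `v` to all of `G`. Subtracting the value at `1` corrects for the
representative of `N` itself, so that the extension restricts to `v`. -/
theorem Height.exists_of_additive {G : Type u} [Group G] {N : Subgroup G} {v : G → ℤ}
    (hv : ∀ m ∈ N, ∀ n ∈ N, v (m * n) = v m + v n) {τ : G} (hτ : τ ∈ N) (hvτ : v τ = 1) :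
    ∃ H : Height N, ∀ n ∈ N, H.ht n = v n := by
  let r : G → G := fun g => ((QuotientGroup.mk g : G ⧸ N).out)⁻¹ * g
  have hr : ∀ g, r g ∈ N := fun g => by
    obtain ⟨n, hn⟩ := QuotientGroup.mk_out_eq_mul N g
    simp only [r, hn]
    simp
  have hrm : ∀ g, ∀ n ∈ N, r (g * n) = r g * n := fun g n hn => by
    have : (QuotientGroup.mk (g * n) : G ⧸ N) = QuotientGroup.mk g := by
      rw [eq_comm, QuotientGroup.eq]; simpa using hn
    simp only [r, this, mul_assoc]
  have hht : ∀ g, ∀ n ∈ N, v (r (g * n)) = v (r g) + v n := fun g n hn => by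
    rw [hrm g n hn, hv _ (hr g) _ hn]
  have hN : ∀ n ∈ N, v (r n) - v (r 1) = v n := fun n hn => by
    have := hht 1 n hn
    rw [one_mul] at this
    linarith
  refine ⟨⟨fun g => v (r g) - v (r 1), τ, hτ, by rw [hN _ hτ, hvτ], fun g n hn => ?_⟩, hN⟩
  rw [hht g n hn, hN n hn]
  ring

theorem Subgroup.exists_mul_zpow_of_mem_sup {B : Type*} [Group B] {C : Subgroup B} {b : B}
    (hb : ∀ c ∈ C, Commute c b) {x : B} (hx : x ∈ C ⊔ Subgroup.zpowers b) :
    ∃ c ∈ C, ∃ v : ℤ, x = c * b ^ v := by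
  rw [Subgroup.sup_eq_closure_mul] at hx
  induction hx using Subgroup.closure_induction with
  | mem x hx =>
    obtain ⟨c, hc, _, ⟨v, rfl⟩, rfl⟩ := hx
    exact ⟨c, hc, v, rfl⟩
  | one => exact ⟨1, C.one_mem, 0, by simp⟩
  | mul x y _ _ hx hy =>
    obtain ⟨c, hc, v, rfl⟩ := hx
    obtain ⟨d, hd, w, rfl⟩ := hy
    refine ⟨c * d, C.mul_mem hc hd, v + w, ?_⟩
    rw [zpow_add, mul_assoc, ← mul_assoc (b ^ v), ← ((hb d hd).zpow_right v).eq]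
    simp only [mul_assoc]
  | inv x _ hx =>
    obtain ⟨c, hc, v, rfl⟩ := hx
    refine ⟨c⁻¹, C.inv_mem hc, -v, ?_⟩
    rw [mul_inv_rev, zpow_neg, ← zpow_neg, ← ((hb _ (C.inv_mem hc)).zpow_right (-v)).eq]

/-- The preimage of `C` under a homomorphism defined on a subgroup `M` of `G`. -/
def Subgroup.preimageIn {G B : Type*} [Group G] [Group B] {M : Subgroup G} (p : M →* B)
    (C : Subgroup B) : Subgroup G := (C.comap p).map M.subtype

theorem Subgroup.mem_preimageIn {G B : Type*} [Group G] [Group B] {M : Subgroup G} {p : M →* B}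
    {C : Subgroup B} {g : G} : g ∈ preimageIn p C ↔ ∃ h : g ∈ M, p ⟨g, h⟩ ∈ C := by
  simp [preimageIn]

namespace SumSystem

variable {G : Type u} {X : Type v} [Group G] [MetricSpace X] [MulAction G X] {c : SumSystem G X}
  [CompactSpace X] [ContinuousConstSMul G X] {B : Type*} [Group B] {M : Subgroup G} {p : M →* B}

open Subgroup

theorem Confines.preimageIn_of_sup_zpowers (hG : Group.ResiduallyFinite G)
    (hp : Function.Surjective p) {C : Subgroup B} {b : B} (hb : ∀ x ∈ C, Commute x b)
    (h : c.Confines (preimageIn p (C ⊔ zpowers b))) : c.Confines (preimageIn p C) := by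
  have hbm : ∀ v : ℤ, b ^ v ∈ C ⊔ zpowers b := fun v => mem_sup_right (zpow_mem (mem_zpowers b) v)
  have hle : preimageIn p C ≤ preimageIn p (C ⊔ zpowers b) := by
    intro g hg
    rw [mem_preimageIn] at hg ⊢
    obtain ⟨hgM, hg⟩ := hg
    exact ⟨hgM, mem_sup_left hg⟩
  obtain ⟨τ, rfl⟩ := hp b
  have hτ : (τ : G) ∈ preimageIn p (C ⊔ zpowers (p τ)) :=
    mem_preimageIn.mpr ⟨τ.2, by simpa using hbm 1⟩
  -- If a nonzero power of `b` lies in `C`, then finitely many cosets suffice. Otherwise the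
  -- exponent of `b` is well defined and is a height whose kernel is the preimage of `C`.
  by_cases hk : ∃ k : ℤ, k ≠ 0 ∧ p τ ^ k ∈ C
  · obtain ⟨k, hk0, hkC⟩ := hk
    refine h.of_finite_cover hle (V := (fun i : ℤ => (τ : G) ^ i) '' Set.Icc 0 |k|)
      ((Set.finite_Icc _ _).image _) fun n hn => ?_
    obtain ⟨hnM, hn⟩ := mem_preimageIn.mp hn
    obtain ⟨x, hx, v, hv⟩ := exists_mul_zpow_of_mem_sup hb hn
    refine ⟨(τ : G) ^ (v % k), ⟨v % k, ⟨Int.emod_nonneg v hk0, (Int.emod_lt_abs v hk0).le⟩, rfl⟩,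
      (τ : G) ^ (-(v % k)) * n, ?_, by simp⟩
    refine mem_preimageIn.mpr ⟨M.mul_mem (zpow_mem τ.2 _) hnM, ?_⟩
    have h1 : (⟨(τ : G) ^ (-(v % k)) * n, M.mul_mem (zpow_mem τ.2 _) hnM⟩ : M) =
        τ ^ (-(v % k)) * ⟨n, hnM⟩ := rfl
    rw [h1, map_mul, map_zpow, hv, ((hb x hx).zpow_right v).eq, ← mul_assoc, ← zpow_add]
    have h2 : -(v % k) + v = k * (v / k) := by have := Int.emod_add_mul_ediv v k; linarith
    rw [h2, zpow_mul]
    exact C.mul_mem (zpow_mem hkC _) hx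
  · push Not at hk
    have huniq : ∀ v w : ℤ, ∀ x ∈ C, ∀ y ∈ C, x * p τ ^ v = y * p τ ^ w → v = w := by
      intro v w x hx y hy hxy
      by_contra hvw
      refine hk (v - w) (sub_ne_zero.mpr hvw) ?_
      have : p τ ^ (v - w) = x⁻¹ * y := by
        rw [zpow_sub, eq_inv_mul_iff_mul_eq, ← mul_assoc, hxy, mul_inv_cancel_right]
      rw [this]
      exact C.mul_mem (C.inv_mem hx) hy
    have hex : ∀ n : G, ∃ v : ℤ, ∀ hn : n ∈ preimageIn p (C ⊔ zpowers (p τ)),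
        ∃ x ∈ C, p ⟨n, (mem_preimageIn.mp hn).1⟩ = x * p τ ^ v := by
      intro n
      by_cases hn : n ∈ preimageIn p (C ⊔ zpowers (p τ))
      · obtain ⟨x, hx, v, hv⟩ := exists_mul_zpow_of_mem_sup hb (mem_preimageIn.mp hn).2
        exact ⟨v, fun _ => ⟨x, hx, hv⟩⟩
      · exact ⟨0, fun h => (hn h).elim⟩
    choose v hv using hex
    obtain ⟨H, hH⟩ := Height.exists_of_additive
      (N := preimageIn p (C ⊔ zpowers (p τ))) (v := v) (by
        intro m hm n hn
        obtain ⟨x, hx, hxm⟩ := hv m hm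
        obtain ⟨y, hy, hyn⟩ := hv n hn
        obtain ⟨z, hz, hzmn⟩ := hv _ (mul_mem hm hn)
        refine huniq _ _ z hz (x * y) (C.mul_mem hx hy) ?_
        rw [← hzmn, zpow_add, mul_assoc, ← mul_assoc y, ((hb y hy).zpow_right (v m)).eq,
          mul_assoc, ← hyn, ← mul_assoc, ← hxm, ← map_mul]
        rfl) hτ (by
        obtain ⟨x, hx, hxτ⟩ := hv _ hτ
        refine huniq _ _ x hx 1 C.one_mem ?_
        rw [← hxτ, one_mul, zpow_one])
    have hker : H.ker = preimageIn p C := by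
      ext n
      rw [H.mem_ker]
      constructor
      · rintro ⟨hn, hn0⟩
        obtain ⟨x, hx, hxn⟩ := hv n hn
        rw [hH n hn] at hn0
        rw [hn0, zpow_zero, mul_one] at hxn
        exact mem_preimageIn.mpr ⟨_, hxn ▸ hx⟩
      · intro hn
        have hn' := hle hn
        obtain ⟨x, hx, hxn⟩ := hv n hn'
        refine ⟨hn', ?_⟩
        rw [hH n hn']
        refine huniq _ _ x hx _ (mem_preimageIn.mp hn).2 ?_
        rw [zpow_zero, mul_one]
        exact hxn.symm
    exact hker ▸ h.ker hG H

theorem Confines.preimageIn_bot (hG : Group.ResiduallyFinite G) (hp : Function.Surjective p)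
    {s : Set B} (hs : s.Finite) (hcomm : ∀ x ∈ closure s, ∀ y ∈ closure s, Commute x y)
    (h : c.Confines (preimageIn p (closure s))) : c.Confines (preimageIn p ⊥) := by
  induction s, hs using Set.Finite.induction_on with
  | empty => rwa [Subgroup.closure_empty] at h
  | @insert b s _ _ ih =>
    have hle : closure s ≤ closure (insert b s) := closure_mono (Set.subset_insert b s)
    refine ih (fun x hx y hy => hcomm x (hle hx) y (hle hy)) ?_
    refine Confines.preimageIn_of_sup_zpowers hG hp (b := b) (fun x hx =>
      hcomm x (hle hx) b (subset_closure (Set.mem_insert _ _))) ?_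
    rwa [Set.insert_eq, Subgroup.closure_union, sup_comm, ← zpowers_eq_closure] at h

/-- One step down a series with locally virtually abelian factors. -/
theorem Confines.exists_le (hG : Group.ResiduallyFinite G) {S T : Subgroup G}
    [(T.subgroupOf S).Normal] (hLVA : IsLocallyVirtuallyAbelian (S ⧸ T.subgroupOf S))
    {N : Subgroup G} (hN : c.Confines N) (hNS : N ≤ S) : ∃ M ≤ T, c.Confines M := by
  obtain ⟨M, hMN, hfg, hM⟩ := hN.exists_fg
  have hMS := hMN.trans hNS
  have : Group.FG M := (Group.fg_iff_subgroup_fg M).mpr hfg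
  let q : M →* S ⧸ T.subgroupOf S := (QuotientGroup.mk' _).comp (inclusion hMS)
  have hq : ∀ n : M, q.rangeRestrict n = 1 → (n : G) ∈ T := by
    intro n hn
    have h1 : q n = 1 := congrArg Subtype.val hn
    have h2 := (QuotientGroup.eq_one_iff (N := T.subgroupOf S) _).mp h1
    exact h2
  have hfgr : q.range.FG := (Group.fg_iff_subgroup_fg _).mp (Group.fg_range q)
  obtain ⟨A, hA, hcomm⟩ := hLVA q.range hfgr
  have : Group.FG q.range := Group.fg_range q
  have hAfg : A.FG := (Group.fg_iff_subgroup_fg A).mp (Subgroup.fg_of_index_ne_zero A)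
  obtain ⟨s, hs, hsfin⟩ := (Subgroup.fg_iff A).mp hAfg
  have hsurj : Function.Surjective q.rangeRestrict := q.rangeRestrict_surjective
  refine ⟨preimageIn q.rangeRestrict ⊥, ?_, ?_⟩
  · intro g hg
    obtain ⟨hgM, hg⟩ := mem_preimageIn.mp hg
    exact hq ⟨g, hgM⟩ (Subgroup.mem_bot.mp hg)
  · refine Confines.preimageIn_bot hG hsurj hsfin ?_ ?_
    · rw [hs]
      intro x hx y hy
      exact congrArg Subtype.val (hcomm.is_comm.comm ⟨x, hx⟩ ⟨y, hy⟩)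
    · rw [hs]
      refine hM.of_relIndex (map_subtype_le _) ?_
      have : (preimageIn q.rangeRestrict A).subgroupOf M = A.comap q.rangeRestrict := by
        rw [preimageIn, subgroupOf, comap_map_eq_self_of_injective M.subtype_injective]
      rw [this]
      exact ⟨by rw [Subgroup.index_comap_of_surjective _ hsurj]; exact hA.index_ne_zero⟩

/-- Over a residually finite group with a locally virtually abelian series, `y` is mortal. -/
theorem exists_iterate_y_eq_o (hG : Group.ResiduallyFinite G)
    (hser : HasLocallyVirtuallyAbelianSeries G) : ∃ n, c.f^[n] c.y = c.o := by
  obtain ⟨n, S, h0, hn, hS⟩ := hser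
  have key : ∀ i ≤ n, ∃ M ≤ S (n - i), c.Confines M := by
    intro i
    induction i with
    | zero => exact fun _ => ⟨⊤, by simp [hn], confines_top c⟩
    | succ i ih =>
      intro hi
      obtain ⟨M, hM, hc⟩ := ih (by omega)
      obtain ⟨_, hnorm, hLVA⟩ := hS (n - (i + 1)) (by omega)
      have h1 : n - i = n - (i + 1) + 1 := by omega
      rw [h1] at hM
      exact hc.exists_le hG hLVA hM
  obtain ⟨M, hM, hc⟩ := key n le_rfl
  rw [Nat.sub_self, h0, le_bot_iff] at hM
  subst hM
  exact hc.exists_iterate_y_eq_o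

end SumSystem

/-! ### Extensions with finite kernel -/

theorem IsVirtuallyAbelian.of_mulEquiv {H K : Type*} [Group H] [Group K] (e : H ≃* K)
    (hK : IsVirtuallyAbelian K) : IsVirtuallyAbelian H := by
  obtain ⟨A, hA, hcomm⟩ := hK
  refine ⟨A.comap e.toMonoidHom,
    ⟨by rw [Subgroup.index_comap_of_surjective _ e.surjective]; exact hA.index_ne_zero⟩, ⟨⟨?_⟩⟩⟩
  rintro ⟨x, hx⟩ ⟨y, hy⟩
  apply Subtype.ext
  apply e.injective
  have := congrArg Subtype.val (hcomm.is_comm.comm ⟨e x, hx⟩ ⟨e y, hy⟩)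
  change e (x * y) = e (y * x)
  rw [map_mul, map_mul]
  exact this

theorem IsLocallyVirtuallyAbelian.of_injective {H K : Type*} [Group H] [Group K] {f : H →* K}
    (hf : Function.Injective f) (hK : IsLocallyVirtuallyAbelian K) :
    IsLocallyVirtuallyAbelian H :=
  fun L hL => (hK (L.map f) (by
    rw [← Group.fg_iff_subgroup_fg] at hL ⊢
    exact Group.fg_of_surjective (f := (L.equivMapOfInjective f hf).toMonoidHom)
      (L.equivMapOfInjective f hf).surjective)).of_mulEquiv (L.equivMapOfInjective f hf)

theorem IsLocallyVirtuallyAbelian.of_finite (H : Type*) [Group H] [Finite H] :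
    IsLocallyVirtuallyAbelian H :=
  fun _ _ => ⟨⊥, inferInstance, inferInstance⟩

/-- The series is pulled back and the finite kernel is inserted at the bottom as one more factor. -/
theorem HasLocallyVirtuallyAbelianSeries.of_finite_ker {H K : Type*} [Group H] [Group K]
    (φ : H →* K) (hφ : Finite φ.ker) (hK : HasLocallyVirtuallyAbelianSeries K) :
    HasLocallyVirtuallyAbelianSeries H := by
  obtain ⟨n, S, h0, hn, hS⟩ := hK
  refine ⟨n + 1, fun i => i.casesOn ⊥ fun i => (S i).comap φ, rfl, by simp [hn], fun i hi => ?_⟩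
  cases i with
  | zero =>
    have : Finite ((S 0).comap φ) := by rw [h0]; exact hφ
    have hnorm : ((⊥ : Subgroup H).subgroupOf ((S 0).comap φ)).Normal := by
      rw [Subgroup.bot_subgroupOf]; infer_instance
    exact ⟨bot_le, hnorm, IsLocallyVirtuallyAbelian.of_finite
      ((S 0).comap φ ⧸ (⊥ : Subgroup H).subgroupOf ((S 0).comap φ))⟩
  | succ i =>
    obtain ⟨hle, hnorm, hLVA⟩ := hS i (by omega)
    have heq : ((S i).comap φ).subgroupOf ((S (i + 1)).comap φ) =
        ((S i).subgroupOf (S (i + 1))).comap (φ.subgroupComap (S (i + 1))) := rfl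
    have hnorm' : (((S i).comap φ).subgroupOf ((S (i + 1)).comap φ)).Normal := by
      rw [heq]; infer_instance
    refine ⟨Subgroup.comap_mono hle, hnorm', hLVA.of_injective
      (f := QuotientGroup.map _ _ (φ.subgroupComap (S (i + 1))) heq.le) ?_⟩
    rw [← MonoidHom.ker_eq_bot_iff, QuotientGroup.ker_map, ← heq, QuotientGroup.map_mk'_self]

/-! ### The invariant core of a tier -/

namespace TieredSystem

variable {𝒳 : TieredSystem.{u, v}} {f : 𝒳.Space → 𝒳.Space}

theorem smul_zeroAt {t : 𝒳.Tier} (g : 𝒳.Grp t) : g • 𝒳.zeroAt t = 𝒳.zeroAt t := 𝒳.smul_zero t g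

theorem IsEvolution.iterate_hom_smul (hf : 𝒳.IsEvolution f) {t s : 𝒳.Tier} (h : t ≤ s)
    {x : 𝒳.set t} (hx : ∀ k, f^[k] x ∈ 𝒳.set s) (g : 𝒳.Grp s) (k : ℕ) :
    f^[k] (𝒳.hom h g • x : 𝒳.set t) = (g • (⟨f^[k] x, hx k⟩ : 𝒳.set s) : 𝒳.set s) := by
  induction k with
  | zero => exact 𝒳.hom_smul h g x
  | succ k ih =>
    have h1 : f (f^[k] x) ∈ 𝒳.set s := by rw [← Function.iterate_succ_apply' f]; exact hx (k + 1)
    have h2 := hf.2 s s le_rfl ⟨f^[k] x, hx k⟩ h1 g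
    rw [𝒳.hom_refl, MonoidHom.id_apply] at h2
    rw [Function.iterate_succ_apply', ih, h2]
    simp only [Function.iterate_succ_apply']

theorem IsEvolution.iterate_smul (hf : 𝒳.IsEvolution f) {s : 𝒳.Tier} {x : 𝒳.set s}
    (hx : ∀ k, f^[k] x ∈ 𝒳.set s) (g : 𝒳.Grp s) (k : ℕ) :
    f^[k] (g • x : 𝒳.set s) = (g • (⟨f^[k] x, hx k⟩ : 𝒳.set s) : 𝒳.set s) := by
  have := hf.iterate_hom_smul le_rfl hx g k
  rwa [𝒳.hom_refl, MonoidHom.id_apply] at this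

/-- The points of the tier `u` whose whole orbit under `f` stays in the tier. -/
def core (hf : 𝒳.IsEvolution f) (u : 𝒳.Tier) : SubMulAction (𝒳.Grp u) (𝒳.set u) where
  carrier := {x | ∀ k, f^[k] x ∈ 𝒳.set u}
  smul_mem' g x hx k := by
    rw [hf.iterate_smul hx]
    exact Subtype.coe_prop _

variable (hf : 𝒳.IsEvolution f) (u : 𝒳.Tier)

instance : CompactSpace (core hf u) := by
  have : CompactSpace (𝒳.set u) := isCompact_iff_compactSpace.mp (𝒳.isCompact_set u)
  refine (isCompact_iff_compactSpace (s := (core hf u : Set (𝒳.set u)))).mp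
    (IsClosed.isCompact ?_)
  have : (core hf u : Set (𝒳.set u)) =
      ⋂ k, {x : 𝒳.set u | f^[k] (x : 𝒳.Space) ∈ 𝒳.set u} := by
    ext x
    simp only [Set.mem_iInter]
    rfl
  rw [this]
  exact isClosed_iInter fun k => (𝒳.isCompact_set u).isClosed.preimage
    ((hf.1.iterate k).comp continuous_subtype_val)

instance : ContinuousConstSMul (𝒳.Grp u) (core hf u) :=
  ⟨fun g => (continuous_subtype_val.const_smul g).subtype_mk _⟩

variable {hf u}

/-- The restriction of the evolution map to the core of a tier. -/
def coreMap (x : core hf u) : core hf u :=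
  ⟨⟨f x, x.2 1⟩, fun k => by
    change f^[k] (f x) ∈ _
    rw [← Function.iterate_succ_apply]
    exact x.2 (k + 1)⟩

theorem coe_coreMap (x : core hf u) : ((coreMap x : 𝒳.set u) : 𝒳.Space) = f x := rfl

theorem coe_iterate_coreMap (x : core hf u) (k : ℕ) :
    ((coreMap^[k] x : 𝒳.set u) : 𝒳.Space) = f^[k] x := by
  induction k with
  | zero => rfl
  | succ k ih => rw [Function.iterate_succ_apply', coe_coreMap, ih, Function.iterate_succ_apply']

theorem core_ext {x y : core hf u} (h : ((x : 𝒳.set u) : 𝒳.Space) = (y : 𝒳.set u)) : x = y :=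
  Subtype.ext (Subtype.ext h)

theorem coreMap_smul (g : 𝒳.Grp u) (x : core hf u) : coreMap (g • x) = g • coreMap x :=
  core_ext (hf.iterate_smul x.2 g 1)

theorem iterate_zero (hf : 𝒳.IsEvolution f) (hnil : IsAsymptoticallyNilpotent 𝒳.zero f) (k : ℕ) :
    f^[k] 𝒳.zero = 𝒳.zero :=
  Function.iterate_fixed (hnil.map_zero hf.1) k

/-- The special point, as a point of the core. -/
def coreZero (hnil : IsAsymptoticallyNilpotent 𝒳.zero f) : core hf u :=
  ⟨𝒳.zeroAt u, fun k => by
    change f^[k] 𝒳.zero ∈ _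
    rw [iterate_zero hf hnil]
    exact 𝒳.zero_mem u⟩

/-- An element of the group of `u` acts on the points of a lower tier through the homomorphism. -/
theorem coe_smul_core {w : 𝒳.Tier} (h : w ≤ u) {z : core hf u}
    (hz : ((z : 𝒳.set u) : 𝒳.Space) ∈ 𝒳.set w) (g : 𝒳.Grp u) :
    (((g • z : core hf u) : 𝒳.set u) : 𝒳.Space) =
      (𝒳.hom h g • (⟨_, hz⟩ : 𝒳.set w) : 𝒳.set w) :=
  (𝒳.hom_smul h g ⟨_, hz⟩).symm

theorem coe_smul_core_mem {w : 𝒳.Tier} (h : w ≤ u) {z : core hf u}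
    (hz : ((z : 𝒳.set u) : 𝒳.Space) ∈ 𝒳.set w) (g : 𝒳.Grp u) :
    (((g • z : core hf u) : 𝒳.set u) : 𝒳.Space) ∈ 𝒳.set w := by
  rw [coe_smul_core h hz]
  exact Subtype.coe_prop _

theorem finite_hom_preimage {t t' : 𝒳.Tier} (h : t ≤ t') {s : Set (𝒳.Grp t)} (hs : s.Finite) :
    (𝒳.hom h ⁻¹' s).Finite :=
  hs.preimage' fun g _ => 𝒳.hom_finite_fibre h g

theorem exists_localEndo_core (hf : 𝒳.IsEvolution f)
    (hnil : IsAsymptoticallyNilpotent 𝒳.zero f) (u : 𝒳.Tier) :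
    ∃ c : LocalEndo (𝒳.Grp u) (core hf u), c.o = coreZero hnil ∧ c.f = coreMap := by
  obtain ⟨Δ, hΔ, -, hexp⟩ := 𝒳.expansive u
  have h4 : 4 * (Δ / 4) = Δ := by ring
  obtain ⟨c, ho, hc, -⟩ := LocalEndo.exists_of_expansive (G := 𝒳.Grp u) (X := core hf u)
    (o := coreZero hnil) (f := coreMap) (η := Δ / 4) (by positivity)
    (fun g => core_ext (congrArg Subtype.val (𝒳.smul_zero u g)))
    (fun x y h => Subtype.ext (hexp _ _ fun g => by rw [h4] at h; exact h g))
    (((hf.1.comp (continuous_subtype_val.comp continuous_subtype_val)).subtype_mk _).subtype_mk _)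
    coreMap_smul (fun x => by
      rw [tendsto_subtype_rng, tendsto_subtype_rng]
      simp only [coe_iterate_coreMap]
      exact hnil x)
  exact ⟨c, ho, hc⟩

/-- The gluing property from the tier `t` to the tier `w`. -/
def Glues (𝒳 : TieredSystem.{u, v}) (t w : 𝒳.Tier) : Prop :=
  ∀ ε > (0 : ℝ), ∃ δ > (0 : ℝ), ∃ E : Set (𝒳.Grp w), E.Finite ∧
    ∀ (I : Type u) (A : I → Set (𝒳.Grp w)) (x : I → 𝒳.set w),
      (∀ i, (x i : 𝒳.Space) ∈ 𝒳.set t) → IsDesignation (𝒳.zeroAt w) δ E A x →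
        ∃ y : 𝒳.set w, IsRealization ε A x y

/-- Families of points of the tier `t` with separated supports have sums in the tier `w`. -/
theorem exists_isSum_core {hnil : IsAsymptoticallyNilpotent 𝒳.zero f} {t w : 𝒳.Tier} (htw : t ≤ w)
    (hglue : 𝒳.Glues t w) (hwu : w ≤ u) (hstab : ∀ x ∈ 𝒳.set w, ∀ k, f^[k] x ∈ 𝒳.set u)
    (c : LocalEndo (𝒳.Grp u) (core hf u)) (hco : c.o = coreZero hnil) :
    ∃ D : Set (𝒳.Grp u), D.Finite ∧ (1 : 𝒳.Grp u) ∈ D ∧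
      ∀ (I : Type u) (x : I → core hf u), (∀ i, ((x i : 𝒳.set u) : 𝒳.Space) ∈ 𝒳.set t) →
        c.Separated D x →
          ∃ z : core hf u, ((z : 𝒳.set u) : 𝒳.Space) ∈ 𝒳.set w ∧ c.IsSum D x z := by
  have hη := c.η_pos
  obtain ⟨δ, hδ, E, hE, hdes⟩ := hglue c.η hη
  obtain ⟨F, hF, hwin⟩ := exists_finite_expansivity_window c.eq_of_close hδ
  set φ := 𝒳.hom hwu with hφ
  -- With this `D`, an element in the `E`-border of a neighbourhood has its whole `F`-window off the
  -- support, hence the orbit is `δ`-close to the special point there.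
  refine ⟨insert 1 ((φ ⁻¹' E) * F⁻¹), ((finite_hom_preimage hwu hE).mul hF.inv).insert 1,
    Set.mem_insert _ _, fun I x hx hsep => ?_⟩
  set D : Set (𝒳.Grp u) := insert 1 ((φ ⁻¹' E) * F⁻¹) with hD
  have hxw : ∀ i, ((x i : 𝒳.set u) : 𝒳.Space) ∈ 𝒳.set w := fun i => 𝒳.set_mono htw (hx i)
  -- The action on these points factors through `φ`, so the neighbourhoods are unions of fibres and
  -- their images still partition the group of `w`.
  have hinv : ∀ i g g', φ g = φ g' → g ∈ D * c.supp (x i) → g' ∈ D * c.supp (x i) := by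
    rintro i _ g' hgg ⟨d, hd, s, hs, rfl⟩
    refine ⟨d, hd, d⁻¹ * g', ?_, mul_inv_cancel_left _ _⟩
    have h1 : (d⁻¹ * g') • x i = s • x i := by
      apply core_ext
      rw [coe_smul_core hwu (hxw i), coe_smul_core hwu (hxw i)]
      have : φ (d⁻¹ * g') = φ s := by rw [map_mul, ← hgg]; simp
      rw [← hφ, this]
    simpa only [LocalEndo.supp, Set.mem_ofPred_eq, h1] using hs
  let A : Option I → Set (𝒳.Grp w) := fun i => i.elim
    (⋃ i, φ '' (D * c.supp (x i)))ᶜ fun i => φ '' (D * c.supp (x i))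
  let x' : Option I → 𝒳.set w := fun i => i.elim (𝒳.zeroAt w) fun i => ⟨x i, hxw i⟩
  have hA : ∀ i g, φ g ∈ A (some i) ↔ g ∈ D * c.supp (x i) := fun i g =>
    ⟨fun ⟨g', hg', h⟩ => hinv i g' g h hg', fun h => ⟨g, h, rfl⟩⟩
  have hdisj : ∀ i j, i ≠ j → Disjoint (A (some i)) (A (some j)) := by
    intro i j hij
    rw [Set.disjoint_left]
    intro g hgi hgj
    obtain ⟨g', rfl⟩ := 𝒳.hom_surjective hwu g
    exact hij (hsep i j g' ((hA i g').mp hgi) ((hA j g').mp hgj))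
  have hnone : ∀ i, Disjoint (A none) (A (some i)) := fun i =>
    Set.disjoint_left.mpr fun g hg hgi => hg (Set.mem_iUnion.mpr ⟨i, hgi⟩)
  obtain ⟨y, hy⟩ := hdes (Option I) A x' (by
      rintro (_ | i)
      exacts [𝒳.zero_mem t, hx i]) ⟨by
      rintro (_ | i) (_ | j) hij
      · exact (hij rfl).elim
      · exact hnone j
      · exact (hnone i).symm
      · exact hdisj i j fun h => hij (congrArg some h), by
      refine Set.eq_univ_of_forall fun g => Set.mem_iUnion.mpr ?_
      by_cases hg : ∃ i, g ∈ A (some i)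
      · obtain ⟨i, hi⟩ := hg
        exact ⟨some i, hi⟩
      · push Not at hg
        exact ⟨none, fun h => by
          obtain ⟨i, hi⟩ := Set.mem_iUnion.mp h
          exact hg i hi⟩, by
      rintro (_ | i) g ⟨hg, e, he, heg⟩
      · change dist (g • 𝒳.zeroAt w) (𝒳.zeroAt w) < δ
        rw [smul_zeroAt, dist_self]
        exact hδ
      · obtain ⟨g', rfl⟩ := 𝒳.hom_surjective hwu g
        obtain ⟨e', rfl⟩ := 𝒳.hom_surjective hwu e
        rw [← hφ, ← map_mul, hA] at heg
        have h1 : dist (g' • x i) c.o < δ := by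
          refine hwin _ _ fun h hh => ?_
          rw [c.smul_o, ← mul_smul]
          refine (LocalEndo.notMem_supp.mp fun hs => heg ?_).trans (by linarith)
          refine ⟨e' * h⁻¹, Set.mem_insert_of_mem _
            (Set.mul_mem_mul he (Set.inv_mem_inv.mpr hh)), _, hs, by group⟩
        rw [hco] at h1
        change dist (((g' • x i : core hf u) : 𝒳.set u) : 𝒳.Space) 𝒳.zero < δ at h1
        rw [coe_smul_core hwu (hxw i)] at h1
        exact h1⟩
  let z : core hf u := ⟨⟨y, 𝒳.set_mono hwu y.2⟩, fun k => hstab y y.2 k⟩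
  have hz : ((z : 𝒳.set u) : 𝒳.Space) ∈ 𝒳.set w := y.2
  refine ⟨z, hz, fun i g hg => ?_, fun g hg => ?_⟩
  · have h1 := hy (some i) (φ g) ((hA i g).mpr hg)
    change dist (((g • z : core hf u) : 𝒳.set u) : 𝒳.Space)
      (((g • x i : core hf u) : 𝒳.set u) : 𝒳.Space) ≤ c.η
    rw [coe_smul_core hwu hz, coe_smul_core hwu (hxw i)]
    exact h1.le
  · have h1 := hy none (φ g) fun h => by
      obtain ⟨i, hi⟩ := Set.mem_iUnion.mp h
      exact hg i ((hA i g).mp hi)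
    rw [hco]
    change dist (((g • z : core hf u) : 𝒳.set u) : 𝒳.Space) 𝒳.zero ≤ c.η
    rw [coe_smul_core hwu hz]
    change dist (φ g • y) (φ g • 𝒳.zeroAt w) < c.η at h1
    rw [smul_zeroAt] at h1
    exact h1.le

theorem finite_supp_of_isHomoclinic {hnil : IsAsymptoticallyNilpotent 𝒳.zero f} {t : 𝒳.Tier}
    (htu : t ≤ u) (c : LocalEndo (𝒳.Grp u) (core hf u)) (hco : c.o = coreZero hnil)
    {y : core hf u} (hyt : ((y : 𝒳.set u) : 𝒳.Space) ∈ 𝒳.set t)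
    (hy : IsHomoclinic (𝒳.Grp t) (𝒳.zeroAt t) ⟨_, hyt⟩) : (c.supp y).Finite := by
  obtain ⟨E, hE, h⟩ := hy c.η c.η_pos
  refine (finite_hom_preimage htu hE).subset fun g hg => ?_
  by_contra hgE
  have h1 := h _ hgE
  refine LocalEndo.notMem_supp.mpr ?_ hg
  rw [hco]
  change dist (((g • y : core hf u) : 𝒳.set u) : 𝒳.Space) 𝒳.zero ≤ c.η
  rw [coe_smul_core htu hyt]
  exact h1.le

/-! ### Mortality of homoclinic points in a tiered system. -/

/-- In a system of class `ℭ₃` over a group with a locally virtually abelian series, an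
asymptotically nilpotent evolution kills every homoclinic point. -/
theorem exists_iterate_eq_zero_of_isHomoclinic (h3 : classThree 𝒳 f)
    (hser : HasLocallyVirtuallyAbelianSeries (𝒳.Grp ⊥))
    (hnil : IsAsymptoticallyNilpotent 𝒳.zero f) {t : 𝒳.Tier} {y : 𝒳.set t}
    (hy : IsHomoclinic (𝒳.Grp t) (𝒳.zeroAt t) y) : ∃ n, f^[n] y = 𝒳.zero := by
  obtain ⟨⟨hf, hstab, hglue, -⟩, hRF⟩ := h3
  -- Gluing and stabilization are used twice: sums of translates of `y` live in `w` and their orbits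
  -- in `s`; sums of points on those orbits live in `w'` and their orbits in `u`. All of this
  -- happens in the core of `u`.
  obtain ⟨w, htw, hw⟩ := hglue t
  obtain ⟨s, hws, hs⟩ := hstab w
  obtain ⟨w', hsw', hw'⟩ := hglue s
  obtain ⟨u, hw'u, hu⟩ := hstab w'
  have hsu : s ≤ u := hsw'.trans hw'u
  have hwu : w ≤ u := hws.trans hsu
  have htu : t ≤ u := htw.trans hwu
  have hs' : ∀ x ∈ 𝒳.set w, ∀ k, f^[k] x ∈ 𝒳.set s := fun x hx k => hs k ⟨x, hx, rfl⟩
  have hu' : ∀ x ∈ 𝒳.set w', ∀ k, f^[k] x ∈ 𝒳.set u := fun x hx k => hu k ⟨x, hx, rfl⟩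
  have hsu' : ∀ x ∈ 𝒳.set w, ∀ k, f^[k] x ∈ 𝒳.set u :=
    fun x hx k => 𝒳.set_mono hsu (hs' x hx k)
  obtain ⟨c, hco, hcf⟩ := exists_localEndo_core hf hnil u
  obtain ⟨D₁, hD₁, hD₁1, hsum₁⟩ := exists_isSum_core htw hw hwu hsu' c hco
  obtain ⟨D₂, hD₂, hD₂1, hsum₂⟩ := exists_isSum_core hsw' hw' hw'u hu' c hco
  let y₀ : core hf u := ⟨⟨y, 𝒳.set_mono htu y.2⟩, hsu' y (𝒳.set_mono htw y.2)⟩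
  have hy₀ : ((y₀ : 𝒳.set u) : 𝒳.Space) ∈ 𝒳.set t := y.2
  have hsupp : (c.supp y₀).Finite := finite_supp_of_isHomoclinic htu c hco hy₀ hy
  have hQ : ∀ a g : 𝒳.Grp u, g ∈ D₁ * c.supp (a⁻¹ • y₀) ↔ g * a⁻¹ ∈ D₁ * c.supp y₀ := by
    intro a g
    constructor
    · rintro ⟨d, hd, s, hs, rfl⟩
      exact ⟨d, hd, _, LocalEndo.mem_supp_smul.mp hs, by group⟩
    · rintro ⟨d, hd, s, hs, hds⟩
      refine ⟨d, hd, s * a, LocalEndo.mem_supp_smul.mpr (by simpa using hs), ?_⟩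
      change d * (s * a) = g
      rw [← mul_assoc, show d * s = g * a⁻¹ from hds, inv_mul_cancel_right]
  have hY : ∀ A : Set (𝒳.Grp u), ∃ z : core hf u, (∀ a ∈ A, ∀ b ∈ A, ∀ g,
      g * a⁻¹ ∈ D₁ * c.supp y₀ → g * b⁻¹ ∈ D₁ * c.supp y₀ → a = b) →
      ((z : 𝒳.set u) : 𝒳.Space) ∈ 𝒳.set w ∧ c.IsSum D₁ (fun a : A => (a : 𝒳.Grp u)⁻¹ • y₀) z := by
    intro A
    by_cases hA : ∀ a ∈ A, ∀ b ∈ A, ∀ g,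
      g * a⁻¹ ∈ D₁ * c.supp y₀ → g * b⁻¹ ∈ D₁ * c.supp y₀ → a = b
    · obtain ⟨z, hz⟩ := hsum₁ A (fun a : A => (a : 𝒳.Grp u)⁻¹ • y₀)
        (fun a => coe_smul_core_mem htu hy₀ _) fun a b g ha hb =>
          Subtype.ext (hA a a.2 b b.2 g ((hQ _ _).mp ha) ((hQ _ _).mp hb))
      exact ⟨z, fun _ => hz⟩
    · exact ⟨y₀, fun h => (hA h).elim⟩
  choose Y hY using hY
  let C : SumSystem (𝒳.Grp u) (core hf u) :=
    { c with
      y := y₀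
      Q := D₁ * c.supp y₀
      D := D₂
      S := {x | ∀ k, ((c.f^[k] x : 𝒳.set u) : 𝒳.Space) ∈ 𝒳.set s}
      Y := Y
      finite_Q := hD₁.mul hsupp
      Y_mem := fun A hA k => by
        rw [hcf, coe_iterate_coreMap]
        exact hs' _ (hY A hA).1 k
      Y_near := fun A hA a ha g hg => (hY A hA).2.1 ⟨a, ha⟩ g ((hQ a g).mpr hg)
      Y_far := fun A hA g hg => (hY A hA).2.2 g fun a h => hg a a.2 ((hQ a g).mp h)
      supp_y := fun g hg => ⟨1, hD₁1, g, hg, one_mul g⟩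
      smul_mem := fun x hx g k => by
        rw [LocalEndo.iterate_smul]
        exact coe_smul_core_mem hsu (hx k) g
      map_mem := fun x hx k => by
        rw [← Function.iterate_succ_apply c.f]
        exact hx (k + 1)
      finite_D := hD₂
      one_mem_D := hD₂1
      exists_isSum := fun I x hx hsep => by
        obtain ⟨z, -, hz⟩ := hsum₂ I x (fun i => hx i 0) hsep
        exact ⟨z, hz⟩ }
  have hfin : Finite (𝒳.hom (bot_le : ⊥ ≤ u)).ker := 𝒳.hom_finite_fibre bot_le 1
  obtain ⟨n, hn⟩ := C.exists_iterate_y_eq_o (hRF u) (hser.of_finite_ker _ hfin)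
  refine ⟨n, ?_⟩
  change c.f^[n] y₀ = c.o at hn
  rw [hcf, hco] at hn
  have := congrArg (fun x : core hf u => ((x : 𝒳.set u) : 𝒳.Space)) hn
  simp only [coe_iterate_coreMap] at this
  exact this

/-! ### From mortal homoclinic points to nilpotency. -/

/-- If homoclinic points are mortal, then the special point is stable on each tier. -/
theorem exists_stable_ball (h2 : classTwo 𝒳 f) (hnil : IsAsymptoticallyNilpotent 𝒳.zero f)
    (hmort : ∀ (t : 𝒳.Tier) (y : 𝒳.set t), IsHomoclinic (𝒳.Grp t) (𝒳.zeroAt t) y →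
      ∃ n, f^[n] y = 𝒳.zero) (s : 𝒳.Tier) {ε : ℝ} (hε : 0 < ε) :
    ∃ ρ > (0 : ℝ), ∃ J : ℕ, ∀ x ∈ 𝒳.set s, dist x 𝒳.zero < ρ → ∀ M ≥ J,
      dist (f^[M] x) 𝒳.zero < ε := by
  obtain ⟨hf, hstab, hglue, hdense⟩ := h2
  obtain ⟨_, ⟨t, y, rfl, hy⟩, ρ, hρ, J, hkill⟩ := hnil.exists_uniformly_attracted hf.1
    (C := {x | ∃ (t : 𝒳.Tier) (y : 𝒳.set t), x = y ∧ IsHomoclinic (𝒳.Grp t) (𝒳.zeroAt t) y})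
    ⟨𝒳.zero, ⊥, 𝒳.zeroAt ⊥, rfl, fun ε hε => ⟨∅, Set.finite_empty, fun g _ => by
      rw [smul_zeroAt, dist_self]; exact hε⟩⟩ (half_pos hε)
  obtain ⟨T, hT⟩ := hmort t y hy
  obtain ⟨a, hta, hsa⟩ := exists_ge_ge t s
  obtain ⟨w, haw, hw⟩ := hglue a
  obtain ⟨u, hwu, hu⟩ := hstab w
  have htu : t ≤ u := hta.trans (haw.trans hwu)
  have hu' : ∀ x ∈ 𝒳.set w, ∀ k, f^[k] x ∈ 𝒳.set u := fun x hx k => hu k ⟨x, hx, rfl⟩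
  obtain ⟨c, hco, hcf⟩ := exists_localEndo_core hf hnil u
  have hη := c.η_pos
  obtain ⟨D, hD, hD1, hsum⟩ := exists_isSum_core haw hw hwu hu' c hco
  let y₀ : core hf u := ⟨⟨y, 𝒳.set_mono htu y.2⟩, hu' y (𝒳.set_mono (hta.trans haw) y.2)⟩
  have hy₀ : ((y₀ : 𝒳.set u) : 𝒳.Space) ∈ 𝒳.set t := y.2
  have hsupp : (c.supp y₀).Finite := finite_supp_of_isHomoclinic htu c hco hy₀ hy
  obtain ⟨W, hW, hwin⟩ := exists_finite_expansivity_window c.eq_of_close (half_pos hρ)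
  have hET := c.pow_E_finite T
  -- A point `x` vanishing on these three sets leaves `y` unchanged on the window `W`, has support
  -- separated from that of `y`, and does not interact with `y` during its lifetime `T`.
  obtain ⟨r, hr, hball⟩ := c.exists_ball_o
    (V := W ∪ D⁻¹ * (D * c.supp y₀) ∪ c.E ^ T * ((c.E ^ T)⁻¹ * c.supp y₀))
    ((hW.union (hD.inv.mul (hD.mul hsupp))).union (hET.mul (hET.inv.mul hsupp)))
  refine ⟨r, hr, max T J, fun x hx hxr M hM => ?_⟩
  let x₀ : core hf u := ⟨⟨x, 𝒳.set_mono (hsa.trans (haw.trans hwu)) hx⟩,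
    hu' x (𝒳.set_mono (hsa.trans haw) hx)⟩
  have hxV := hball x₀ (by rw [hco]; exact hxr)
  obtain ⟨z, hzw, hz⟩ := hsum (Option PUnit) (fun i => i.elim x₀ fun _ => y₀) (by
      rintro (_ | _)
      exacts [𝒳.set_mono hsa hx, 𝒳.set_mono hta y.2]) (by
      have key : ∀ g, g ∈ D * c.supp y₀ → g ∉ D * c.supp x₀ := by
        rintro _ hg ⟨d, hd, b, hb, rfl⟩
        exact hxV b (Or.inl (Or.inr ⟨d⁻¹, Set.inv_mem_inv.mpr hd, _, hg, by simp⟩)) hb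
      rintro (_ | _) (_ | _) g hi hj
      · rfl
      · exact (key g hj hi).elim
      · exact (key g hi hj).elim
      · rfl)
  have hyy : c.IsSum D (fun _ : PUnit => y₀) y₀ :=
    ⟨fun _ g _ => by rw [dist_self]; exact hη.le, fun g hg =>
      LocalEndo.notMem_supp.mp fun h => hg PUnit.unit ⟨1, hD1, g, h, one_mul g⟩⟩
  have hsup : c.Superposes y₀ x₀ z := hyy.superposes_option hD1 hz
  have hTy : c.f^[T] y₀ = c.o := by
    rw [hcf, hco]
    apply core_ext
    rw [coe_iterate_coreMap]
    exact hT
  have hfz : f^[M] ((z : 𝒳.set u) : 𝒳.Space) = f^[M] x := by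
    have h1 := hsup.iterate_eq (T := T) (by
      intro p hp q hq k hk k' hk' h
      refine hxV q (Or.inr ⟨k', hk', _, ⟨k⁻¹, Set.inv_mem_inv.mpr hk, p, hp, rfl⟩, ?_⟩) hq
      change k' * (k⁻¹ * p) = q
      rw [h, mul_inv_cancel_left]) hTy (le_of_max_le_left hM)
    rw [hcf] at h1
    have h2 := congrArg (fun x : core hf u => ((x : 𝒳.set u) : 𝒳.Space)) h1
    simp only [coe_iterate_coreMap] at h2
    exact h2
  have hzy : dist ((z : 𝒳.set u) : 𝒳.Space) y < ρ / 2 :=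
    hwin z y₀ fun h hh => hsup.1 h (hxV h (Or.inl (Or.inl hh)))
  -- The sum `z` need not be homoclinic, so it is approximated by a homoclinic `y'`. Here `δ` may
  -- depend on `M`, as the attraction time `J` does not depend on `y'`.
  obtain ⟨δ, hδ, hcont⟩ := Metric.continuousAt_iff.mp
    ((hf.1.iterate M).continuousAt (x := ((z : 𝒳.set u) : 𝒳.Space))) (ε / 2) (half_pos hε)
  obtain ⟨t', -, y', hy', hhom⟩ := hdense w z hzw (min δ (ρ / 2)) (lt_min hδ (half_pos hρ))
  rw [dist_comm] at hy'
  have h1 := hkill y' ⟨t', y', rfl, hhom⟩ (by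
    have := dist_triangle (y' : 𝒳.Space) ((z : 𝒳.set u) : 𝒳.Space) y
    have := min_le_right δ (ρ / 2)
    linarith) M (le_of_max_le_right hM)
  have h2 := hcont (hy'.trans_le (min_le_left _ _))
  rw [← hfz]
  have h3 := dist_triangle_left (f^[M] ((z : 𝒳.set u) : 𝒳.Space)) 𝒳.zero (f^[M] y')
  linarith

/-- By compactness all points of the tier have entered the stable ball by a common time. Afterwards
they stay `Δ`-close to zero; applied to all translates of a point, expansivity makes its iterate
equal to zero. -/
theorem isNilpotentMapOn_of_mortal (h2 : classTwo 𝒳 f)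
    (hnil : IsAsymptoticallyNilpotent 𝒳.zero f)
    (hmort : ∀ (t : 𝒳.Tier) (y : 𝒳.set t), IsHomoclinic (𝒳.Grp t) (𝒳.zeroAt t) y →
      ∃ n, f^[n] y = 𝒳.zero) (t : 𝒳.Tier) : IsNilpotentMapOn 𝒳.zero f (𝒳.set t) := by
  obtain ⟨hf, hstab, -, -⟩ := id h2
  obtain ⟨s, hts, hs⟩ := hstab t
  have hs' : ∀ x ∈ 𝒳.set t, ∀ k, f^[k] x ∈ 𝒳.set s := fun x hx k => hs k ⟨x, hx, rfl⟩
  obtain ⟨Δ, hΔ, -, hexp⟩ := 𝒳.expansive s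
  obtain ⟨ρ, hρ, J, hJ⟩ := exists_stable_ball h2 hnil hmort s hΔ
  obtain ⟨K, hK⟩ := (𝒳.isCompact_set t).elim_finite_subcover
    (fun k => {x | dist (f^[k] x) 𝒳.zero < ρ})
    (fun k => isOpen_lt ((hf.1.iterate k).dist continuous_const) continuous_const)
    (fun x _ => by
      obtain ⟨k, hk⟩ := Metric.tendsto_atTop.mp (hnil x) ρ hρ
      exact Set.mem_iUnion.mpr ⟨k, hk k le_rfl⟩)
  obtain ⟨n, hn⟩ : ∃ n, ∀ k ∈ K, k ≤ n := ⟨K.sup id, fun k hk => Finset.le_sup (f := id) hk⟩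
  have hclose : ∀ x ∈ 𝒳.set t, dist (f^[n + J] x) 𝒳.zero < Δ := by
    intro x hx
    obtain ⟨k, hk, hkx⟩ := Set.mem_iUnion₂.mp (hK hx)
    have := hJ _ (hs' x hx k) hkx (n + J - k) (by have := hn k hk; omega)
    rwa [← Function.iterate_add_apply, Nat.sub_add_cancel (by have := hn k hk; omega)] at this
  refine ⟨n + J, fun x hx => ?_⟩
  have := hexp ⟨f^[n + J] x, hs' x hx _⟩ (𝒳.zeroAt s) fun g => by
    rw [smul_zeroAt]
    have h1 := hf.iterate_hom_smul hts (x := ⟨x, hx⟩) (hs' x hx) g (n + J)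
    have h2 := hclose _ (Subtype.coe_prop (𝒳.hom hts g • (⟨x, hx⟩ : 𝒳.set t)))
    rw [h1] at h2
    exact h2.le
  exact congrArg Subtype.val this

end TieredSystem

theorem IsNilRigidOn.classThree_of_series {G : Type u} [Group G]
    (hser : HasLocallyVirtuallyAbelianSeries G) : IsNilRigidOn classThree.{u, v} G := by
  rintro 𝒳 ⟨e⟩ f - h3 hnil t
  have hser' : HasLocallyVirtuallyAbelianSeries (𝒳.Grp ⊥) :=
    hser.of_finite_ker e.toMonoidHom (by
      rw [(MonoidHom.ker_eq_bot_iff _).mpr e.injective]; infer_instance)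
  exact TieredSystem.isNilpotentMapOn_of_mortal h3.1 hnil
    (fun _ _ hy => TieredSystem.exists_iterate_eq_zero_of_isHomoclinic h3 hser' hnil hy) t

/-! ### Systems with a single tier -/

/-- Asymptotically nilpotent endomorphisms of expansive `0`-gluing pointed `G`-systems with dense
homoclinic points are nilpotent. -/
def IsNilRigidOnSystems (G : Type u) [Group G] : Prop :=
  ∀ (X : Type v) [MetricSpace X] [CompactSpace X] [MulAction G X] [ContinuousConstSMul G X]
    (o : X), (∀ g : G, g • o = o) → IsExpansive G X → IsZeroGluing G o →
    Dense {x : X | IsHomoclinic G o x} → ∀ f : X → X, IsEndomorphism G o f →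
    IsAsymptoticallyNilpotent o f → ∃ n, ∀ x, f^[n] x = o

section Restriction

variable {G : Type u} {X : Type v} [Group G] [MetricSpace X] [MulAction G X]

/-- The points that are `η`-close to `o` outside the subgroup `Γ`. -/
def supportedOn (Γ : Subgroup G) (o : X) (η : ℝ) : SubMulAction Γ X where
  carrier := {x | ∀ g ∉ Γ, dist (g • x) o ≤ η}
  smul_mem' γ x hx g hg := by
    have := hx (g * γ) fun h => hg ((Γ.mul_mem_cancel_right γ.2).mp h)
    rwa [mul_smul] at this

variable {Γ : Subgroup G} {o : X} {η : ℝ}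

instance [CompactSpace X] [ContinuousConstSMul G X] : CompactSpace (supportedOn Γ o η) := by
  refine (isCompact_iff_compactSpace (s := (supportedOn Γ o η : Set X))).mp (IsClosed.isCompact ?_)
  have : (supportedOn Γ o η : Set X) = ⋂ g ∉ Γ, {x : X | dist (g • x) o ≤ η} := by
    ext x
    simp only [Set.mem_iInter]
    rfl
  rw [this]
  exact isClosed_iInter fun g => isClosed_iInter fun _ =>
    isClosed_le ((continuous_const_smul g).dist continuous_const) continuous_const

instance [ContinuousConstSMul G X] : ContinuousConstSMul Γ (supportedOn Γ o η) :=
  ⟨fun γ => (continuous_subtype_val.const_smul (γ : G)).subtype_mk _⟩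

theorem eq_of_close_supportedOn (hη : 0 ≤ η)
    (hexp : ∀ x y : X, (∀ g : G, dist (g • x) (g • y) ≤ 4 * η) → x = y) (x y : supportedOn Γ o η)
    (h : ∀ γ : Γ, dist (γ • x) (γ • y) ≤ 4 * η) : x = y := by
  refine Subtype.ext (hexp _ _ fun g => ?_)
  by_cases hg : g ∈ Γ
  · exact h ⟨g, hg⟩
  · have h1 := x.2 g hg
    have h2 := y.2 g hg
    have h3 := dist_triangle_right (g • (x : X)) (g • (y : X)) o
    linarith

/-- Designations on a subgroup that contains the gluing set extend by `o`. -/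
theorem exists_realization_of_subgroup {δ : ℝ} {E : Set G} (ho : ∀ g : G, g • o = o) (hδ : 0 < δ)
    (hEΓ : E ⊆ Γ)
    (hglue : ∀ (I : Type u) (A : I → Set G) (x : I → X), IsDesignation o δ E A x →
      ∃ y : X, IsRealization η A x y)
    {I : Type u} {A : I → Set Γ} {x : I → X}
    (hA : IsDesignation o δ (Subtype.val ⁻¹' E : Set Γ) A x) :
    ∃ y ∈ supportedOn Γ o η, IsRealization η A x y := by
  obtain ⟨hdisj, hcov, hbord⟩ := hA
  have hnone : ∀ i, Disjoint ((Γ : Set G)ᶜ) (Subtype.val '' A i) := fun i =>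
    Set.disjoint_left.mpr fun g hg ⟨γ, _, h⟩ => hg (h ▸ γ.2)
  obtain ⟨y, hy⟩ := hglue (Option I)
    (fun i => i.elim (Γ : Set G)ᶜ fun i => Subtype.val '' A i) (fun i => i.elim o x) ⟨by
      rintro (_ | i) (_ | j) hij
      · exact (hij rfl).elim
      · exact hnone j
      · exact (hnone i).symm
      · exact (Set.disjoint_image_iff Subtype.val_injective).mpr
          (hdisj fun h => hij (congrArg some h)), by
      refine Set.eq_univ_of_forall fun g => Set.mem_iUnion.mpr ?_
      by_cases hg : g ∈ Γ
      · obtain ⟨i, hi⟩ := Set.mem_iUnion.mp (hcov ▸ Set.mem_univ (⟨g, hg⟩ : Γ))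
        exact ⟨some i, ⟨g, hg⟩, hi, rfl⟩
      · exact ⟨none, hg⟩, by
      rintro (_ | i) g ⟨hg, e, he, heg⟩
      · simpa [ho] using hδ
      · obtain ⟨γ, hγ, rfl⟩ := hg
        exact hbord i γ ⟨hγ, ⟨e, hEΓ he⟩, he, fun h => heg ⟨_, h, rfl⟩⟩⟩
  refine ⟨y, fun g hg => ?_, fun i γ hγ => hy (some i) γ ⟨γ, hγ, rfl⟩⟩
  have := hy none g hg
  simp only [Option.elim_none, ho] at this
  exact this.le

end Restriction

/-- On an expansive system, gluing at one scale implies gluing at all scales. -/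
theorem IsZeroGluing.of_one_scale {G : Type u} {X : Type v} [Group G] [MetricSpace X]
    [MulAction G X] [CompactSpace X] [ContinuousConstSMul G X] {o : X} {η : ℝ} (hη : 0 < η)
    (ho : ∀ g : G, g • o = o)
    (hexp : ∀ x y : X, (∀ g : G, dist (g • x) (g • y) ≤ 4 * η) → x = y) {δ : ℝ} (hδ : 0 < δ)
    {E : Set G} (hE : E.Finite)
    (hglue : ∀ (I : Type u) (A : I → Set G) (x : I → X), IsDesignation o δ E A x →
      ∃ y : X, IsRealization η A x y) : IsZeroGluing G o := by
  intro ε hε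
  obtain ⟨F, hF, hwin⟩ := exists_finite_expansivity_window hexp (half_pos hε)
  -- If the window `F * g` leaves the part `A i`, the added elements `F`, `F⁻¹` and `F * F⁻¹` put
  -- `g` and all of `F * g` in borders. Then both `y` and `x i` are close to `o` at `g`.
  refine ⟨min δ (min η (ε / 2)), by positivity, E ∪ (F ∪ F⁻¹ ∪ F * F⁻¹),
    hE.union ((hF.union hF.inv).union (hF.mul hF.inv)), fun I A x ⟨hdisj, hcov, hbord⟩ => ?_⟩
  have hδ' : min δ (min η (ε / 2)) ≤ δ := min_le_left _ _
  have hη' : min δ (min η (ε / 2)) ≤ η := (min_le_right _ _).trans (min_le_left _ _)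
  have hε' : min δ (min η (ε / 2)) ≤ ε / 2 := (min_le_right _ _).trans (min_le_right _ _)
  obtain ⟨y, hy⟩ := hglue I A x ⟨hdisj, hcov, fun i g ⟨hg, e, he, heg⟩ =>
    (hbord i g ⟨hg, e, Or.inl he, heg⟩).trans_le hδ'⟩
  refine ⟨y, fun i g hg => ?_⟩
  by_cases hFg : ∀ h ∈ F, h * g ∈ A i
  · refine (hwin _ _ fun h hh => ?_).trans (half_lt_self hε)
    have := hy i _ (hFg h hh)
    rw [mul_smul, mul_smul] at this
    linarith
  · push Not at hFg
    obtain ⟨h', hh', hh'g⟩ := hFg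
    have h1 := hbord i g ⟨hg, h', Or.inr (Or.inl (Or.inl hh')), hh'g⟩
    have h2 : dist (g • y) o < ε / 2 := by
      refine hwin _ _ fun h hh => ?_
      obtain ⟨j, hj⟩ := Set.mem_iUnion.mp (hcov ▸ Set.mem_univ (h * g))
      have h3 : dist ((h * g) • x j) o < min δ (min η (ε / 2)) := by
        by_cases hij : i = j
        · subst hij
          refine hbord i _ ⟨hj, h' * h⁻¹, Or.inr (Or.inr
            (Set.mul_mem_mul hh' (Set.inv_mem_inv.mpr hh))), ?_⟩
          rwa [mul_assoc, inv_mul_cancel_left]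
        · refine hbord j _ ⟨hj, h⁻¹, Or.inr (Or.inl (Or.inr (Set.inv_mem_inv.mpr hh))), ?_⟩
          rw [inv_mul_cancel_left]
          exact Set.disjoint_left.mp (hdisj hij) hg
      have h4 := hy j _ hj
      have h5 := dist_triangle ((h * g) • y) ((h * g) • x j) o
      rw [ho, ← mul_smul]
      linarith
    have h3 := dist_triangle_right (g • y) (g • x i) o
    linarith

/-- Nil-rigidity of the finitely generated subgroups implies nil-rigidity. -/
theorem IsNilRigidOnSystems.of_fg {G : Type u} [Group G]
    (h : ∀ Γ : Subgroup G, Γ.FG → IsNilRigidOnSystems.{u, v} Γ) : IsNilRigidOnSystems.{u, v} G := by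
  intro X _ _ _ _ o ho hexp hglue hdense f hf hnil
  obtain ⟨Δ, hΔ, hΔ1, hexp⟩ := hexp
  have hη : 0 < Δ / 4 := by positivity
  have hΔ4 : Δ = 4 * (Δ / 4) := by ring
  rw [hΔ4] at hexp
  obtain ⟨c, rfl, rfl, hcη⟩ := LocalEndo.exists_of_expansive hη ho hexp hf.1 hf.2.2 hnil
  rw [← hcη] at hexp hη hΔ4
  obtain ⟨δ, hδ, E, hE, hdes⟩ := hglue c.η hη
  -- Containing the memory set makes cosets evolve independently, so `f` preserves the points
  -- supported on `Γ`. Containing the gluing set allows truncation to `Γ`.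
  let Γ := Subgroup.closure (c.E ∪ E)
  have hcE : c.E ⊆ Γ := Set.subset_union_left.trans Subgroup.subset_closure
  have hEΓ : E ⊆ Γ := Set.subset_union_right.trans Subgroup.subset_closure
  have hfg : Γ.FG := (Subgroup.fg_iff Γ).mpr ⟨_, rfl, c.finite_E.union hE⟩
  have htrunc : ∀ x : X, ∃ y : supportedOn Γ c.o c.η,
      ∀ γ ∈ Γ, dist (γ • (y : X)) (γ • x) < c.η := by
    intro x
    obtain ⟨y, hy, hr⟩ := exists_realization_of_subgroup (Γ := Γ) ho hδ hEΓ hdes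
      (I := PUnit) (A := fun _ => Set.univ) (x := fun _ => x)
      ⟨fun i j hij => (hij rfl).elim, by simp [Set.iUnion_const],
        fun i g ⟨_, e, _, he⟩ => (he (Set.mem_univ _)).elim⟩
    exact ⟨⟨y, hy⟩, fun γ hγ => hr PUnit.unit ⟨γ, hγ⟩ (Set.mem_univ _)⟩
  have hexp' := eq_of_close_supportedOn (Γ := Γ) (o := c.o) hη.le hexp
  let o' : supportedOn Γ c.o c.η := ⟨c.o, fun g _ => by rw [ho, dist_self]; exact hη.le⟩
  have ho' : ∀ γ : Γ, γ • o' = o' := fun γ => Subtype.ext (ho γ)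
  let f' : supportedOn Γ c.o c.η → supportedOn Γ c.o c.η := fun x =>
    ⟨c.f x, fun g hg => LocalEndo.dist_smul_map_o_le fun e he =>
      (x.2 (e * g) fun h => hg ((Γ.mul_mem_cancel_left (hcE he)).mp h)).trans (by linarith)⟩
  have hf' : ∀ n x, ((f'^[n] x : supportedOn Γ c.o c.η) : X) = c.f^[n] x := by
    intro n x
    induction n with
    | zero => rfl
    | succ n ih =>
      rw [Function.iterate_succ_apply', Function.iterate_succ_apply', ← ih]
  obtain ⟨n, hn⟩ := h Γ hfg (supportedOn Γ c.o c.η) o' ho'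
    ⟨Δ, hΔ, hΔ1, fun x y hxy => hexp' x y (by rwa [← hΔ4])⟩
    (IsZeroGluing.of_one_scale hη ho' hexp' hδ
      (hE.preimage Subtype.val_injective.injOn) fun I A x hA => by
        obtain ⟨y, hy, hr⟩ := exists_realization_of_subgroup (Γ := Γ) ho hδ hEΓ hdes
          (A := A) (x := fun i => (x i : X)) hA
        exact ⟨⟨y, hy⟩, hr⟩)
    (by
      rw [Metric.dense_iff]
      intro x ε hε
      obtain ⟨F, hF, hwin⟩ := exists_finite_expansivity_window hexp' hε
      have hev : ∀ᶠ z in 𝓝 (x : X), ∀ γ ∈ F, dist ((γ : G) • z) ((γ : G) • (x : X)) < c.η := by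
        rw [hF.eventually_all]
        intro γ _
        exact Metric.tendsto_nhds.mp ((continuous_const_smul (γ : G)).tendsto (x : X)) c.η hη
      -- Truncating a homoclinic point of `X` near `x` gives a homoclinic point of the restricted
      -- system near `x`.
      obtain ⟨z, hzhom, hz⟩ := (hdense.inter_nhds_nonempty hev)
      obtain ⟨y, hy⟩ := htrunc z
      refine ⟨y, hwin y x fun γ hγ => ?_, fun ε' hε' => ?_⟩
      · have h1 := hy γ γ.2
        have h2 := hz γ hγ
        have h3 := dist_triangle ((γ : G) • (y : X)) ((γ : G) • z) ((γ : G) • (x : X))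
        change dist ((γ : G) • (y : X)) ((γ : G) • (x : X)) ≤ _
        linarith
      · obtain ⟨F', hF', hwin'⟩ := exists_finite_expansivity_window hexp' hε'
        obtain ⟨K, hK, hKz⟩ := hzhom c.η hη
        refine ⟨F'⁻¹ * (Subtype.val ⁻¹' K), hF'.inv.mul (hK.preimage Subtype.val_injective.injOn),
          fun γ hγ => hwin' _ _ fun h hh => ?_⟩
        have h1 := hy (h * γ) (Γ.mul_mem h.2 γ.2)
        have h2 := hKz (h * γ) fun hmem => hγ ⟨h⁻¹, Set.inv_mem_inv.mpr hh, h * γ, hmem, by simp⟩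
        have h3 := dist_triangle (((h : G) * γ) • (y : X)) (((h : G) * γ) • z) c.o
        rw [ho', ← mul_smul]
        change dist (((h : G) * γ) • (y : X)) c.o ≤ _
        linarith) f'
    ⟨(hf.1.comp continuous_subtype_val).subtype_mk _, Subtype.ext hf.2.1,
      fun γ x => Subtype.ext (hf.2.2 γ x)⟩
    (fun x => by
      rw [tendsto_subtype_rng]
      simp only [hf']
      exact hnil x)
  refine ⟨n, fun x => hexp _ _ fun g => ?_⟩
  rw [ho, ← LocalEndo.iterate_smul]
  -- The value of the iterate near the identity depends only on `E ^ n`, which lies in `Γ`, so the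
  -- truncation can be used instead, and it dies by time `n`.
  obtain ⟨y, hy⟩ := htrunc (g • x)
  have hpow : ∀ j, c.E ^ j ⊆ Γ := by
    intro j
    induction j with
    | zero => simp
    | succ j ih => rw [pow_succ]; exact (Set.mul_subset_mul ih hcE).trans (by simp)
  have h1 := LocalEndo.dist_smul_iterate_le (c := c) (x := y) (y := g • x) (j := n) (g := 1)
    fun k hk => by
      rw [mul_one]
      exact (hy k (hpow n hk)).le.trans (by linarith)
  rw [one_smul, one_smul, ← hf', hn, dist_comm] at h1
  exact h1

/-! ### Passing between systems and single-tier systems -/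

section OfSystem

variable {G : Type u} [Group G] {X : Type v} [MetricSpace X] [CompactSpace X] [MulAction G X]
  [ContinuousConstSMul G X] {o : X}

/-- The action on the whole space, as an action on the set `Set.univ`. -/
abbrev univMulAction (G : Type u) [Group G] (X : Type v) [MulAction G X] :
    MulAction G (Set.univ : Set X) where
  smul g x := ⟨g • (x : X), trivial⟩
  one_smul x := Subtype.ext (one_smul G (x : X))
  mul_smul g h x := Subtype.ext (mul_smul g h (x : X))

attribute [local instance] univMulAction in
/-- An expansive pointed system, as a tiered system with a single tier. -/
def TieredSystem.ofSystem (ho : ∀ g : G, g • o = o) (hexp : IsExpansive G X) :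
    TieredSystem.{u, v} where
  Space := X
  zero := o
  Tier := PUnit
  Grp _ := G
  set _ := Set.univ
  isCompact_set _ := isCompact_univ
  mulAction _ := univMulAction G X
  continuousConstSMul _ :=
    ⟨fun g => (continuous_subtype_val.const_smul g).subtype_mk _⟩
  zero_mem _ := trivial
  smul_zero _ g := Subtype.ext (ho g)
  expansive _ := by
    obtain ⟨Δ, h0, h1, h⟩ := hexp
    exact ⟨Δ, h0, h1, fun x y hxy => Subtype.ext (h x y hxy)⟩
  set_mono _ := le_rfl
  hom _ := MonoidHom.id G
  hom_surjective _ := Function.surjective_id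
  hom_finite_fibre _ g := Set.finite_singleton g
  hom_refl _ := rfl
  hom_comp _ _ := rfl
  hom_smul _ _ _ := rfl

theorem TieredSystem.classTwo_ofSystem (ho : ∀ g : G, g • o = o) (hexp : IsExpansive G X)
    (hglue : IsZeroGluing G o) (hdense : Dense {x : X | IsHomoclinic G o x}) {f : X → X}
    (hf : IsEndomorphism G o f) : classTwo (ofSystem ho hexp) f := by
  refine ⟨⟨hf.1, fun _ _ _ x _ g => hf.2.2 g x.1⟩, fun t => ⟨t, le_rfl, fun k => Set.subset_univ _⟩,
    fun t => ⟨t, le_rfl, fun ε hε => ?_⟩, fun t x _ ε hε => ?_⟩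
  · obtain ⟨δ, hδ, E, hE, h⟩ := hglue ε hε
    refine ⟨δ, hδ, E, hE, fun I A x _ hA => ?_⟩
    obtain ⟨y, hy⟩ := h I A (fun i => (x i).1) hA
    exact ⟨⟨y, trivial⟩, hy⟩
  · obtain ⟨y, hy, hxy⟩ := hdense.exists_dist_lt x hε
    exact ⟨t, le_rfl, ⟨y, trivial⟩, hxy, hy⟩

end OfSystem

/-- The hypothesis `hℭ` isolates what is needed of the class on single-tier systems, so that the
three alternatives are handled alike. -/
theorem IsNilRigidOnSystems.of_isNilRigidOn {ℭ : EvolutionClass.{u, v}} {G K : Type u} [Group G]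
    [Group K] (e : K ≃* G) (hG : IsNilRigidOn ℭ G)
    (hℭ : ∀ (𝒳 : TieredSystem.{u, v}) (f : 𝒳.Space → 𝒳.Space), classTwo 𝒳 f →
      Subsingleton 𝒳.Tier → (𝒳.Grp ⊥ ≃* K) → ℭ 𝒳 f) : IsNilRigidOnSystems.{u, v} K := by
  intro X _ _ _ _ o ho hexp hglue hdense f hf hnil
  have h2 := TieredSystem.classTwo_ofSystem ho hexp hglue hdense hf
  obtain ⟨n, hn⟩ := hG (TieredSystem.ofSystem ho hexp) ⟨e⟩ f h2.1
    (hℭ _ _ h2 (inferInstanceAs (Subsingleton PUnit)) (MulEquiv.refl K)) hnil ⊥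
  exact ⟨n, fun x => hn x trivial⟩

theorem Group.ResiduallyFinite.of_mulEquiv {G K : Type*} [Group G] [Group K] (e : K ≃* G)
    (hG : Group.ResiduallyFinite G) : Group.ResiduallyFinite K := by
  rw [Group.residuallyFinite_iff_exists_finiteIndex] at hG ⊢
  intro g hg
  obtain ⟨H, hH, hgH⟩ := hG (e g) (by simpa using hg)
  exact ⟨H.comap e.toMonoidHom,
    ⟨by rw [Subgroup.index_comap_of_surjective _ e.surjective]; exact hH.index_ne_zero⟩, hgH⟩

theorem IsNilRigidOnSystems.of_locally {G K : Type u} [Group G] [Group K] (e : K ≃* G)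
    (h : IsLocallyNilRigidOn classTwo.{u, v} G ∨ IsLocallyNilRigidOn classFour.{u, v} G ∨
      (IsLocallyNilRigidOn classThree.{u, v} G ∧
        ∀ H : Subgroup G, H.FG → Group.ResiduallyFinite H)) :
    IsNilRigidOnSystems.{u, v} K := by
  refine IsNilRigidOnSystems.of_fg fun Γ hΓ => ?_
  let e' : Γ ≃* Γ.map e.toMonoidHom := Γ.equivMapOfInjective e.toMonoidHom e.injective
  have hfg : (Γ.map e.toMonoidHom).FG := by
    rw [← Group.fg_iff_subgroup_fg] at hΓ ⊢
    exact Group.fg_of_surjective (f := e'.toMonoidHom) e'.surjective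
  rcases h with h | h | ⟨h, hRF⟩
  · exact .of_isNilRigidOn e' (h _ hfg) fun 𝒳 f h2 _ _ => h2
  · exact .of_isNilRigidOn e' (h _ hfg) fun 𝒳 f h2 hT _ => ⟨h2, hT⟩
  · refine .of_isNilRigidOn e' (h _ hfg) fun 𝒳 f h2 hT e'' => ⟨h2, fun t => ?_⟩
    rw [hT.elim t ⊥]
    exact (hRF _ hfg).of_mulEquiv (e''.trans e')

theorem IsNilRigidOnSystems.isNilpotentMapOn {𝒳 : TieredSystem.{u, v}}
    (h : IsNilRigidOnSystems.{u, v} (𝒳.Grp ⊥)) {f : 𝒳.Space → 𝒳.Space} (h4 : classFour 𝒳 f)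
    (hnil : IsAsymptoticallyNilpotent 𝒳.zero f) (t : 𝒳.Tier) :
    IsNilpotentMapOn 𝒳.zero f (𝒳.set t) := by
  obtain ⟨⟨hf, hstab, hglue, hdense⟩, hT⟩ := h4
  obtain rfl := hT.elim t ⊥
  -- With one tier, stabilization says that `f` preserves it, so the tier is an ordinary pointed
  -- system with `f` as endomorphism.
  obtain ⟨s, -, hs⟩ := hstab ⊥
  obtain rfl := hT.elim s ⊥
  have : CompactSpace (𝒳.set ⊥) := isCompact_iff_compactSpace.mp (𝒳.isCompact_set ⊥)
  have hmem : ∀ x ∈ 𝒳.set ⊥, ∀ k, f^[k] x ∈ 𝒳.set ⊥ := fun x hx k => hs k ⟨x, hx, rfl⟩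
  let f' : 𝒳.set ⊥ → 𝒳.set ⊥ := fun x => ⟨f x, hmem x x.2 1⟩
  have hf' : ∀ n x, ((f'^[n] x : 𝒳.set ⊥) : 𝒳.Space) = f^[n] x := by
    intro n x
    induction n with
    | zero => rfl
    | succ n ih => rw [Function.iterate_succ_apply', Function.iterate_succ_apply', ← ih]
  obtain ⟨n, hn⟩ := h (𝒳.set ⊥) (𝒳.zeroAt ⊥) (𝒳.smul_zero ⊥) (𝒳.expansive ⊥)
    (by
      intro ε hε
      obtain ⟨w, -, hw⟩ := hglue ⊥
      obtain rfl := hT.elim w ⊥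
      obtain ⟨δ, hδ, E, hE, hdes⟩ := hw ε hε
      exact ⟨δ, hδ, E, hE, fun I A x => hdes I A x fun i => (x i).2⟩)
    (by
      rw [Metric.dense_iff]
      intro x ε hε
      obtain ⟨t', -, y, hxy, hy⟩ := hdense ⊥ x x.2 ε hε
      obtain rfl := hT.elim t' ⊥
      rw [dist_comm] at hxy
      exact ⟨y, hxy, hy⟩) f'
    ⟨(hf.1.comp continuous_subtype_val).subtype_mk _, Subtype.ext (hnil.map_zero hf.1),
      fun g x => Subtype.ext (hf.iterate_smul (hmem x x.2) g 1)⟩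
    (fun x => by
      rw [tendsto_subtype_rng]
      simp only [hf']
      exact hnil x)
  refine ⟨n, fun x hx => ?_⟩
  have := congrArg Subtype.val (hn ⟨x, hx⟩)
  rwa [hf'] at this

/-! ### Assembly of the three statements. -/

theorem mainTheorem1 :
    -- nilpotency of asymptotically nilpotent endomorphisms
    (∀ (G : Type u) [Group G],
      (∀ H : Subgroup G, H.FG →
        Group.ResiduallyFinite H ∧ HasLocallyVirtuallyAbelianSeries H) →
      ∀ (X : Type v) [MetricSpace X] [CompactSpace X] [MulAction G X] [ContinuousConstSMul G X]
        (o : X), (∀ g : G, g • o = o) →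
        IsExpansive G X → IsZeroGluing G o → Dense {x : X | IsHomoclinic G o x} →
        ∀ f : X → X, IsEndomorphism G o f → IsAsymptoticallyNilpotent o f →
          IsNilpotentMap o f) ∧
    -- nil-rigidity on tiered systems with residually finite groups
    (∀ (G : Type u) [Group G], Group.ResiduallyFinite G → HasLocallyVirtuallyAbelianSeries G →
      IsNilRigidOn classThree.{u, v} G) ∧
    -- from local nil-rigidity to nil-rigidity on single-tier systems
    (∀ (G : Type u) [Group G],
      (IsLocallyNilRigidOn classTwo.{u, v} G ∨ IsLocallyNilRigidOn classFour.{u, v} G ∨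
        (IsLocallyNilRigidOn classThree.{u, v} G ∧
          ∀ H : Subgroup G, H.FG → Group.ResiduallyFinite H)) →
      IsNilRigidOn classFour.{u, v} G) := by
  refine ⟨?_, fun G _ _ hser => .classThree_of_series hser, ?_⟩
  · intro G _ hG X _ _ _ _ o ho hexp hglue hdense f hf hnil
    have hloc : IsLocallyNilRigidOn classThree.{u, v} G :=
      fun H hH => .classThree_of_series (hG H hH).2
    obtain ⟨n, hn⟩ := IsNilRigidOnSystems.of_locally (MulEquiv.refl G)
      (Or.inr (Or.inr ⟨hloc, fun H hH => (hG H hH).1⟩)) X o ho hexp hglue hdense f hf hnil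
    exact ⟨n, Set.eq_singleton_iff_unique_mem.mpr
      ⟨⟨o, hn o⟩, fun y ⟨x, hx⟩ => hx ▸ hn x⟩⟩
  · rintro G _ h 𝒳 ⟨e⟩ f - h4 hnil t
    exact (IsNilRigidOnSystems.of_locally e h).isNilpotentMapOn h4 hnil t
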